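/- **Setting.** For a finite set $P\subset\mathbb R^d$, a *2-sided query* is an open box $q=(a_1,b_1)\times\cdots\times(a_d,b_d)$ in which exactly two of the $2d$ bounds are finite, all other $a_i$ being $-\infty$ and all other $b_i$ being $+\infty$; its answer is $P\cap q$, and $k=|P\cap q|$. *Pointer machine.* A data structure is a directed graph with out-degree at most two and a root, each vertex of which stores at most one point. A query is answered (reported) in time $T$ if there is a set of at most $T$ vertices, containing the root and with each of its vertices reachable from the root inside the set, in which every point of $P\cap q$ is stored. The space is the number of vertices. *Semigroup model.* Each point $x\in P$ has a weight $w(x)$ in a commutative semigroup $G$. A data structure consists of precomputed sums $s_1,\dots,s_S$ with $s_i=\sum_{x\in I_i}\alpha_{i,x}w(x)$, where the $\alpha_{i,x}$ are positive integers and $I_i$ does not depend on $w$. For each query $q$ it picks a set $J_q$ of these sums, not depending on $w$, such that for every $w$ one has $\sum_{x\in P\cap q}w(x)=\sum_{i\in J_q}\mu_{q,i}s_i$ with positive integers $\mu_{q,i}$. The query time is $|J_q|$ and the space is $S$. Either (a) the integers $\alpha,\mu$ do not depend on $w$ and $G$ is faithful, i.e. for nonempty finite $I,I'$, if $\sum_{i\in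 I}\alpha_i g_i=\sum_{i\in I'}\alpha'_i g_i$ (with fixed positive integers $\alpha_i,\alpha_i'$) for every assignment of values in $G$ to the variables $g_i$, then $I=I'$; or (b) the integers $\alpha,\mu$ may depend on $w$ and $G$ is faithful in the sense that for nonempty finite $I,I'$, if for every assignment $g$ there are positive integers $\alpha'_i$ with $\sum_{i\in I}g_i=\sum_{i\in I'}\alpha'_i g_i$, then $I=I'$. **Theorem.** Write $n=md$. 1. (Reporting.) There are functions $\delta,\eta:\mathbb N\to\mathbb R$ tending to $0$ at infinity such that for every constant $A$ there are $c>0$ and $m_0$ with the following property. For all $m\ge m_0$ and all $d\ge1$ there is a set $P$ of $m$ points in $\mathbb R^d$ such that every pointer machine data structure that answers every 2-sided query on $P$ in time $m^{1-\delta(m)}+A k$ uses space at least $c\,n^{2-\eta(n)}/m$. That is, query time $m^{1-o(1)}+O(k)$ requires $\Omega(n^{2-o(1)}/m)$ space. 2. (Searching.) Suppose $\log d\le m^{o(1)}$, i.e. let $\gamma:\mathbb N\to\mathbb R$ with $\gamma(m)\to0$. There are functions $\delta,\eta:\mathbb N\to\mathbb R$ tending to $0$ at infinity, a constant $c>0$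 and an $m_0$ such that for all $m\ge m_0$ and all $d\ge1$ with $\log d\le m^{\gamma(m)}$ there is a set $P$ of $m$ points in $\mathbb R^d$ such that for every $G$, every data structure in the semigroup model, in either setting (a) or (b), that answers every 2-sided query on $P$ in time $m^{1-\delta(m)}$ uses space at least $c\,n^{2-\eta(n)}/m^2$. That is, query time $m^{1-o(1)}$ requires $\Omega(n^{2-o(1)}/m^2)$ space. -/

import Mathlib

open Filter Topology

/-! ### Two-sided orthogonal range queries -/

/-- A two-sided query in dimension `d`: an axis-aligned open box
`(lo 0, hi 0) × ⋯ × (lo (d-1), hi (d-1))`, in which exactly two of the `2 d` bounds are finite;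
all the other lower bounds are `-∞` and all the other upper bounds are `+∞`. -/
structure TwoSidedQuery (d : ℕ) where
  lo : Fin d → WithBot ℝ
  hi : Fin d → WithTop ℝ
  two_sides : {i | lo i ≠ ⊥}.ncard + {i | hi i ≠ ⊤}.ncard = 2

open Classical in
/-- The points of `P` contained in the query box. -/
noncomputable def TwoSidedQuery.answer {d : ℕ} (q : TwoSidedQuery d)
    (P : Finset (Fin d → ℝ)) : Finset (Fin d → ℝ) :=
  P.filter fun p => ∀ i, q.lo i < ((p i : ℝ) : WithBot ℝ) ∧ ((p i : ℝ) : WithTop ℝ) < q.hi i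

/-! ### The pointer machine model -/

/-- A pointer machine data structure: a directed graph on `size` memory cells with a root, where
every cell has at most two outgoing pointers and stores at most one input element. -/
structure PointerStructure (U : Type*) where
  size : ℕ
  root : Fin size
  next : Fin size → Fin 2 → Option (Fin size)
  elem : Fin size → Option U

namespace PointerStructure

variable {U : Type*} (D : PointerStructure U)

/-- `V` can be explored from the root: it contains the root, and each of its cells is reached from
the root by following pointers between cells of `V`. -/
def IsExplored (V : Finset (Fin D.size)) : Prop :=
  D.root ∈ V ∧ ∀ v ∈ V,
    Relation.ReflTransGen (fun a b => a ∈ V ∧ b ∈ V ∧ ∃ i, D.next a i = some b) D.root v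

/-- The elements of `A` can all be found by exploring at most `T` cells. -/
def ReportsWithin (A : Finset U) (T : ℝ) : Prop :=
  ∃ V : Finset (Fin D.size), D.IsExplored V ∧ (V.card : ℝ) ≤ T ∧
    ∀ x ∈ A, ∃ v ∈ V, D.elem v = some x

end PointerStructure

/-! ### The semigroup model

A commutative semigroup `G` need not have a neutral element, so sums are formed in `WithZero G`,
where a new zero is adjoined as the value of the empty sum. -/

/-- The linear form `∑ x ∈ I, a x • w x`. -/
def linForm {U G : Type*} [AddCommSemigroup G] (w : U → G) (I : Finset U) (a : U → ℕ) :
    WithZero G :=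
  ∑ x ∈ I, a x • (w x : WithZero G)

/-- A faithful semigroup: two linear forms with positive integer coefficients that agree under
every assignment of semigroup values to the variables involve the same variables. (The coefficients
are not required to agree, so that for example `(ℝ, max)` is faithful.) -/
def FaithfulSemigroup (G : Type*) [AddCommSemigroup G] : Prop :=
  ∀ I I' : Finset ℕ, I.Nonempty → I'.Nonempty → ∀ a a' : ℕ → ℕ,
    (∀ i ∈ I, 0 < a i) → (∀ i ∈ I', 0 < a' i) →
    (∀ g : ℕ → G, linForm g I a = linForm g I' a') → I = I'

/-- Faithfulness for coefficients that may depend on the assignment: if under every assignment the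
plain sum of the variables in `I` is *some* positive integer combination of the variables in `I'`,
then `I = I'`. -/
def AdaptivelyFaithfulSemigroup (G : Type*) [AddCommSemigroup G] : Prop :=
  ∀ I I' : Finset ℕ, I.Nonempty → I'.Nonempty →
    (∀ g : ℕ → G, ∃ a' : ℕ → ℕ, (∀ i ∈ I', 0 < a' i) ∧
      linForm g I (fun _ => 1) = linForm g I' a') → I = I'

/-- The weight-independent part of a data structure in the semigroup model: the number `size` of
precomputed sums, the set `supp i` of elements occurring in the `i`-th precomputed sum, and the set
`pick q` of precomputed sums that are combined to answer the query `q`. -/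
structure SumScheme (U Q : Type*) where
  size : ℕ
  supp : Fin size → Finset U
  pick : Q → Finset (Fin size)

namespace SumScheme

variable {U Q : Type*} (D : SumScheme U Q)

/-- Under the weights `w`, with coefficients `coef` in the precomputed sums and with the picked sums
used with multiplicities `mult`, every query `q` obtains the total weight of its answer `ans q`. -/
def Evaluates {G : Type*} [AddCommSemigroup G] (ans : Q → Finset U) (w : U → G)
    (coef : Fin D.size → U → ℕ) (mult : Q → Fin D.size → ℕ) : Prop :=
  (∀ i, ∀ x ∈ D.supp i, 0 < coef i x) ∧ (∀ q, ∀ i ∈ D.pick q, 0 < mult q i) ∧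
    ∀ q, linForm w (ans q) (fun _ => 1) =
      ∑ i ∈ D.pick q, mult q i • linForm w (D.supp i) (coef i)

/-- The scheme answers all queries for all weights in `G`, with fixed coefficients. -/
def Solves (G : Type*) [AddCommSemigroup G] (ans : Q → Finset U) : Prop :=
  ∃ coef mult, ∀ w : U → G, D.Evaluates ans w coef mult

/-- The scheme answers all queries for all weights in `G`, with coefficients that may depend on the
weights. -/
def SolvesAdaptively (G : Type*) [AddCommSemigroup G] (ans : Q → Finset U) : Prop :=
  ∀ w : U → G, ∃ coef mult, D.Evaluates ans w coef mult

end SumScheme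

/-! ### Codes without many words agreeing in many positions -/

/-! Both bounds rest on one instance with about `(d / 2) ^ 2` queries, each answered by `B` points,
in which any `β` points lie together in at most `r ^ 2` of these answers. A random code
(`exists_code`) gives `h` words of length `B` over `Fin N` such that fewer than `r` of them agree
with any fixed word on any `β` positions. The points are triples `(y, a, b)` in `B × N × N`. One
family of sets fixes `a = ω i y`, the other `b = ω j y`, so the intersection for `(i, j)` has one
point per position `y`, and `β` common points pin `i` and `j` to fewer than `r` values each
(`exists_hard_instance`). Pairwise intersections of arbitrary sets, one set per coordinate, are
answers of 2-sided queries (`exists_points_of_sets`).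

Searching: faithfulness forces the picked supports to have the answer as their union. A fast query
therefore uses a sum with at least `β` points, and such a sum serves at most `r ^ 2` of the queries.

Reporting: the explored cells contain a tree of pointers, which is cut into pieces with at least `β`
marked cells, most of them of size `O(β)` (`exists_pieces`). The points marked in a small piece are
determined by its top cell and a binary pattern, with `2 ^ O(β)` choices, and each resulting set
serves at most `r ^ 2` queries (`card_mul_le_size`). A slowly growing alphabet `N = 2 ^ L`, with `L`
about `log log m`, makes `β` about `log d / L`, so that `2 ^ O(β)` is `n ^ o(1)`. If `d` is so large
that `B < 2 * β`, there are more queries than pointer patterns explorable from the root, and no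
structure meets the time bound. -/

theorem card_filter_forall_mem_eq {α : Type*} [Fintype α] [DecidableEq α] {N : ℕ}
    (Z : Finset α) (g : α → Fin N) :
    (Finset.univ.filter fun f : α → Fin N => ∀ x ∈ Z, f x = g x).card * N ^ Z.card
      = N ^ Fintype.card α := by
  have h : (Finset.univ.filter fun f : α → Fin N => ∀ x ∈ Z, f x = g x)
      = Fintype.piFinset fun x => if x ∈ Z then {g x} else Finset.univ := by
    ext f
    simp only [Finset.mem_filter, Finset.mem_univ, true_and, Fintype.mem_piFinset]
    refine forall_congr' fun x => ?_
    by_cases hx : x ∈ Z <;> simp [hx]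
  have h3 : N ^ Z.card = ∏ x : α, if x ∈ Z then N else 1 := by
    rw [Finset.prod_ite_mem, Finset.univ_inter, Finset.prod_const]
  rw [h, Fintype.card_piFinset, h3, ← Finset.prod_mul_distrib]
  have h4 : ∀ x, (if x ∈ Z then ({g x} : Finset (Fin N)) else Finset.univ).card
      * (if x ∈ Z then N else 1) = N := by
    intro x
    by_cases hx : x ∈ Z <;> simp [hx]
  simp [h4]

/-- Union bound over the choice of `r` words, `β` positions and `β` prescribed values: a fixed
choice is realised with probability `N ^ (-r * β)`, and there are at most `h ^ r * (B * N) ^ β`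
choices. -/
theorem exists_code {h B N β r : ℕ} (hβ : 0 < β) (hN : 0 < N) (h1 : h ^ 2 ≤ N ^ β)
    (h2 : (B * N) ^ 2 < N ^ r) :
    ∃ ω : Fin h → Fin B → Fin N, ∀ (c : Fin B → Fin N) (Y : Finset (Fin B)), β ≤ Y.card →
      (Finset.univ.filter fun i => ∀ y ∈ Y, ω i y = c y).card < r := by
  classical
  by_contra! hcon
  let bad : (Fin r ↪ Fin h) × (Fin β ↪ Fin B) × (Fin β → Fin N) →
      Finset (Fin h × Fin B → Fin N) := fun t =>
    Finset.univ.filter fun ω => ∀ a b, ω (t.1 a, t.2.1 b) = t.2.2 b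
  have hcard : ∀ t, (bad t).card * N ^ (r * β) ≤ N ^ (h * B) := by
    intro t
    rcases (bad t).eq_empty_or_nonempty with he | ⟨ω₀, h₀⟩
    · simp [he]
    have h₀' := (Finset.mem_filter.1 h₀).2
    have key := card_filter_forall_mem_eq
      ((Finset.univ : Finset (Fin r × Fin β)).map (t.1.prodMap t.2.1)) ω₀
    simp only [Finset.card_map, Finset.card_univ, Fintype.card_prod, Fintype.card_fin] at key
    rw [← key]
    refine Nat.mul_le_mul_right _ (Finset.card_le_card fun ω hω => ?_)
    have hω' := (Finset.mem_filter.1 hω).2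
    simp only [Finset.mem_filter, Finset.mem_univ, true_and, Finset.mem_map, Prod.exists]
    rintro x ⟨a, b, rfl⟩
    exact (hω' a b).trans (h₀' a b).symm
  have hcover : (Finset.univ : Finset (Fin h × Fin B → Fin N)) ⊆ Finset.univ.biUnion bad := by
    intro ω _
    obtain ⟨c, Y, hY, hr⟩ := hcon fun i y => ω (i, y)
    obtain ⟨R', hR', hR''⟩ := Finset.exists_subset_card_eq hr
    obtain ⟨Y', hY', hY''⟩ := Finset.exists_subset_card_eq hY
    let f : Fin r ↪ Fin h := (R'.orderEmbOfFin hR'').toEmbedding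
    let g : Fin β ↪ Fin B := (Y'.orderEmbOfFin hY'').toEmbedding
    refine Finset.mem_biUnion.2 ⟨(f, g, fun b => c (g b)), Finset.mem_univ _, ?_⟩
    refine Finset.mem_filter.2 ⟨Finset.mem_univ _, fun a b => ?_⟩
    exact (Finset.mem_filter.1 (hR' (Finset.orderEmbOfFin_mem R' hR'' a))).2 _
      (hY' (Finset.orderEmbOfFin_mem Y' hY'' b))
  have hle : N ^ (h * B) * N ^ (r * β) ≤ h ^ r * (B ^ β * N ^ β) * N ^ (h * B) := by
    have e1 : N ^ (h * B) ≤ ∑ t, (bad t).card := by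
      have := (Finset.card_le_card hcover).trans Finset.card_biUnion_le
      simpa using this
    calc N ^ (h * B) * N ^ (r * β) ≤ (∑ t, (bad t).card) * N ^ (r * β) :=
          Nat.mul_le_mul_right _ e1
      _ = ∑ t, (bad t).card * N ^ (r * β) := Finset.sum_mul _ _ _
      _ ≤ ∑ _t : (Fin r ↪ Fin h) × (Fin β ↪ Fin B) × (Fin β → Fin N), N ^ (h * B) :=
          Finset.sum_le_sum fun t _ => hcard t
      _ ≤ h ^ r * (B ^ β * N ^ β) * N ^ (h * B) := by
          simp only [Finset.sum_const, smul_eq_mul, Finset.card_univ, Fintype.card_prod,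
            Fintype.card_embedding_eq, Fintype.card_fun, Fintype.card_fin]
          gcongr <;> exact Nat.descFactorial_le_pow _ _
  have hle' : N ^ (r * β) ≤ h ^ r * (B * N) ^ β := by
    have hp : 0 < N ^ (h * B) := pow_pos hN _
    rw [mul_pow]
    nlinarith
  -- After squaring, each hypothesis pays for one factor: `h1` bounds the choice of words, `h2` that
  -- of positions and values.
  have hlt : (h ^ r * (B * N) ^ β) ^ 2 < (N ^ (r * β)) ^ 2 := by
    calc (h ^ r * (B * N) ^ β) ^ 2 = (h ^ 2) ^ r * ((B * N) ^ 2) ^ β := by ring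
      _ ≤ (N ^ β) ^ r * ((B * N) ^ 2) ^ β := by gcongr
      _ < (N ^ β) ^ r * (N ^ r) ^ β := by
          have : 0 < (N ^ β) ^ r := by positivity
          have := Nat.pow_lt_pow_left h2 hβ.ne'
          gcongr
      _ = (N ^ (r * β)) ^ 2 := by ring
  exact absurd (lt_of_pow_lt_pow_left₀ 2 (Nat.zero_le _) hlt) (not_lt.2 hle')

/-! ### From set systems to two-sided queries -/

/-- Coordinate `i` lies below the threshold `m` exactly on `A i`, so upper bounds `m` on coordinates
`i` and `j` cut out the intersection. The offset `x` keeps the points distinct. -/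
theorem exists_points_of_sets {m d : ℕ} (hd : 1 ≤ d) (A : Fin d → Finset (Fin m)) :
    ∃ pt : Fin m ↪ (Fin d → ℝ),
      (∀ i j, i ≠ j → ∃ q : TwoSidedQuery d,
        q.answer (Finset.univ.map pt) = (A i ∩ A j).map pt) ∧
      ∃ q : TwoSidedQuery d, q.answer (Finset.univ.map pt) = Finset.univ.map pt := by
  classical
  let f : Fin m → Fin d → ℝ := fun x i => if x ∈ A i then (x : ℝ) else (x : ℝ) + m
  have hlt : ∀ x i, f x i < m ↔ x ∈ A i := by
    intro x i
    have h1 : (x : ℝ) < m := by exact_mod_cast x.2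
    have h2 : (0 : ℝ) ≤ x := Nat.cast_nonneg _
    by_cases h : x ∈ A i
    · simp [f, h]
    · simp [f, h]
  have hinj : Function.Injective f := by
    intro x y hxy
    have h0 := congrFun hxy ⟨0, hd⟩
    have h1 : (x : ℝ) < m := by exact_mod_cast x.2
    have h2 : (y : ℝ) < m := by exact_mod_cast y.2
    have h3 : (0 : ℝ) ≤ x := Nat.cast_nonneg _
    have h4 : (0 : ℝ) ≤ y := Nat.cast_nonneg _
    have h5 : (x : ℝ) = y := by
      simp only [f] at h0
      split_ifs at h0 <;> linarith
    exact Fin.ext (by exact_mod_cast h5)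
  refine ⟨⟨f, hinj⟩, fun i j hij => ?_, ?_⟩
  · refine ⟨⟨fun _ => ⊥, fun l => if l = i ∨ l = j then ((m : ℝ) : WithTop ℝ) else ⊤, ?_⟩, ?_⟩
    · have : {l | (if l = i ∨ l = j then ((m : ℝ) : WithTop ℝ) else ⊤) ≠ ⊤} = {i, j} := by
        ext l
        by_cases h : l = i ∨ l = j
        · simpa [h] using or_iff_not_imp_left.1 h
        · simpa [h] using not_or.1 h
      rw [this, Set.ncard_pair hij]
      simp
    · ext p
      simp only [TwoSidedQuery.answer, Finset.mem_filter, Finset.mem_map, Finset.mem_univ,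
        true_and, Function.Embedding.coeFn_mk, Finset.mem_inter, WithBot.bot_lt_coe]
      constructor
      · rintro ⟨⟨x, rfl⟩, hx⟩
        refine ⟨x, ⟨(hlt x i).1 ?_, (hlt x j).1 ?_⟩, rfl⟩
        · have := hx i
          simp only [true_or, if_true] at this
          exact_mod_cast this
        · have := hx j
          simp only [or_true, if_true] at this
          exact_mod_cast this
      · rintro ⟨x, ⟨hi, hj⟩, rfl⟩
        refine ⟨⟨x, rfl⟩, fun l => ?_⟩
        by_cases h : l = i ∨ l = j
        · simp only [h, if_true]
          rcases h with rfl | rfl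
          · exact_mod_cast (hlt x _).2 hi
          · exact_mod_cast (hlt x _).2 hj
        · simp only [h, if_false]
          exact WithTop.coe_lt_top _
  -- Both finite bounds are spent on one coordinate, whose values all lie in `[0, 2 * m)`.
  · let z : Fin d := ⟨0, hd⟩
    refine ⟨⟨fun l => if l = z then ((-1 : ℝ) : WithBot ℝ) else ⊥,
      fun l => if l = z then ((2 * m : ℝ) : WithTop ℝ) else ⊤, ?_⟩, ?_⟩
    · have h1 : {l | (if l = z then ((-1 : ℝ) : WithBot ℝ) else ⊥) ≠ ⊥} = {z} := by
        ext l
        by_cases h : l = z <;> simp [h]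
      have h2 : {l | (if l = z then ((2 * m : ℝ) : WithTop ℝ) else ⊤) ≠ ⊤} = {z} := by
        ext l
        by_cases h : l = z
        · simp only [h, Set.mem_ofPred_eq, if_true, Set.mem_singleton_iff, iff_true]
          exact WithTop.coe_ne_top
        · simp [h]
      rw [h1, h2]
      simp
    · refine Finset.filter_true_of_mem fun p hp l => ?_
      obtain ⟨x, -, rfl⟩ := Finset.mem_map.1 hp
      have h1 : (x : ℝ) < m := by exact_mod_cast x.2
      have h2 : (0 : ℝ) ≤ x := Nat.cast_nonneg _
      by_cases h : l = z
      · simp only [h, if_true, Function.Embedding.coeFn_mk, WithBot.coe_lt_coe,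
          WithTop.coe_lt_coe, f]
        split_ifs <;> constructor <;> linarith
      · simp only [h, if_false]
        exact ⟨WithBot.bot_lt_coe _, WithTop.coe_lt_top _⟩

/-- A point set with many queries whose answers have size `B`, such that few of these answers
contain any given set of `β` points. -/
theorem exists_hard_instance {m d h B N β r : ℕ} (hd : 1 ≤ d) (hhd : 2 * h ≤ d) (hβ : 0 < β)
    (hN : 0 < N) (hBm : B * N ^ 2 ≤ m) (h1 : h ^ 2 ≤ N ^ β) (h2 : (B * N) ^ 2 < N ^ r) :
    ∃ P : Finset (Fin d → ℝ), P.card = m ∧ (∃ q : TwoSidedQuery d, q.answer P = P) ∧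
      ∃ Q : Fin h × Fin h → TwoSidedQuery d, (∀ t, ((Q t).answer P).card = B) ∧
        ∀ X : Finset (Fin d → ℝ), β ≤ X.card → ∀ I : Finset (Fin h × Fin h),
          (∀ t ∈ I, X ⊆ (Q t).answer P) → I.card ≤ r ^ 2 := by
  classical
  obtain ⟨ω, hω⟩ := exists_code hβ hN h1 h2
  have hemb : Nonempty (Fin B × Fin N × Fin N ↪ Fin m) := by
    apply Function.Embedding.nonempty_of_card_le
    simpa [sq] using hBm
  obtain ⟨emb⟩ := hemb
  let A : Fin d → Finset (Fin m) := fun l =>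
    if hl : l.1 < h then Finset.univ.filter fun x => ∃ y b, x = emb (y, ω ⟨l, hl⟩ y, b)
    else if hl' : l.1 - h < h then
      Finset.univ.filter fun x => ∃ y a, x = emb (y, a, ω ⟨l.1 - h, hl'⟩ y)
    else ∅
  obtain ⟨pt, hpt, hall⟩ := exists_points_of_sets hd A
  let i₁ : Fin h → Fin d := fun i => ⟨i, by omega⟩
  let i₂ : Fin h → Fin d := fun j => ⟨j + h, by omega⟩
  have hA₁ : ∀ i x, x ∈ A (i₁ i) ↔ ∃ y b, x = emb (y, ω i y, b) := by
    intro i x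
    simp [A, i₁]
  have hA₂ : ∀ i x, x ∈ A (i₂ i) ↔ ∃ y a, x = emb (y, a, ω i y) := by
    intro i x
    simp [A, i₂]
  have hne : ∀ i j, i₁ i ≠ i₂ j := by
    intro i j hij
    have := congrArg Fin.val hij
    simp only [i₁, i₂] at this
    omega
  choose Q hQ using fun t : Fin h × Fin h => hpt (i₁ t.1) (i₂ t.2) (hne _ _)
  let φ : Fin h × Fin h → Fin B ↪ (Fin d → ℝ) := fun t =>
    ⟨fun y => pt (emb (y, ω t.1 y, ω t.2 y)), fun y y' hy => by
      have := emb.injective (pt.injective hy)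
      exact (Prod.ext_iff.1 this).1⟩
  have hans : ∀ t, (Q t).answer (Finset.univ.map pt) = Finset.univ.map (φ t) := by
    intro t
    rw [hQ]
    ext p
    simp only [Finset.mem_map, Finset.mem_inter, hA₁, hA₂, Finset.mem_univ, true_and]
    constructor
    · rintro ⟨x, ⟨⟨y, b, rfl⟩, ⟨y', a, h'⟩⟩, rfl⟩
      have := emb.injective h'
      simp only [Prod.mk.injEq] at this
      obtain ⟨rfl, -, rfl⟩ := this
      exact ⟨y, rfl⟩
    · rintro ⟨y, rfl⟩
      exact ⟨_, ⟨⟨y, _, rfl⟩, ⟨y, _, rfl⟩⟩, rfl⟩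
  refine ⟨Finset.univ.map pt, by simp, hall, Q, fun t => by simp [hans], fun X hX I hI => ?_⟩
  rcases I.eq_empty_or_nonempty with rfl | ⟨t₀, ht₀⟩
  · simp
  have hX₀ := hI t₀ ht₀
  rw [hans] at hX₀
  obtain ⟨Y, rfl⟩ : ∃ Y : Finset (Fin B), X = Y.map (φ t₀) := by
    obtain ⟨Y, -, hY⟩ := Finset.subset_map_iff.1 hX₀
    exact ⟨Y, hY⟩
  rw [Finset.card_map] at hX
  -- A point of the form `φ t₀ y` in another answer must sit at the same position `y`, so both code
  -- words of `t` agree on `Y` with those of `t₀`.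
  have hsub : I ⊆ (Finset.univ.filter fun i => ∀ y ∈ Y, ω i y = ω t₀.1 y) ×ˢ
      (Finset.univ.filter fun i => ∀ y ∈ Y, ω i y = ω t₀.2 y) := by
    intro t ht
    have key : ∀ y ∈ Y, ω t.1 y = ω t₀.1 y ∧ ω t.2 y = ω t₀.2 y := by
      intro y hy
      have := hI t ht (Finset.mem_map_of_mem _ hy)
      rw [hans] at this
      obtain ⟨y', -, h'⟩ := Finset.mem_map.1 this
      have := emb.injective (pt.injective h')
      simp only [Prod.mk.injEq] at this
      obtain ⟨rfl, h3, h4⟩ := this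
      exact ⟨h3, h4⟩
    simp only [Finset.mem_product, Finset.mem_filter, Finset.mem_univ, true_and]
    exact ⟨fun y hy => (key y hy).1, fun y hy => (key y hy).2⟩
  calc I.card ≤ _ := Finset.card_le_card hsub
    _ ≤ r * r := by
      rw [Finset.card_product]
      exact Nat.mul_le_mul (hω _ Y hX).le (hω _ Y hX).le
    _ = r ^ 2 := (sq r).symm

/-! ### Exploration trees in the pointer machine model -/

/-- Finite binary trees with labelled nodes. -/
inductive BTree (α : Type*) where
  | nil : BTree α
  | node : α → BTree α → BTree α → BTree α

namespace BTree

variable {α β : Type*}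

/-- The labels, in preorder. -/
def toList : BTree α → List α
  | nil => []
  | node v l r => v :: (l.toList ++ r.toList)

/-- Relabelling. -/
def map (f : α → β) : BTree α → BTree β
  | nil => nil
  | node v l r => node (f v) (l.map f) (r.map f)

theorem length_toList_map (f : α → β) (t : BTree α) :
    (t.map f).toList.length = t.toList.length := by
  induction t with
  | nil => rfl
  | node v l r hl hr => simp [map, toList, hl, hr]

/-- `t` is a tree of pointers that hangs from the pointer `o`. -/
def HangsFrom (next : α → Fin 2 → Option α) : BTree α → Option α → Prop
  | nil, _ => True
  | node v l r, o => o = some v ∧ l.HangsFrom next (next v 0) ∧ r.HangsFrom next (next v 1)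

/-- The new cell becomes a leaf in slot `i` of `a`. That slot is free: a nonempty subtree there
would have `b` as its top label. -/
theorem HangsFrom.exists_insert {next : α → Fin 2 → Option α} {a b : α} {i : Fin 2}
    (hab : next a i = some b) (t : BTree α) : ∀ {o : Option α}, t.HangsFrom next o →
      a ∈ t.toList → b ∉ t.toList →
      ∃ t' : BTree α, t'.HangsFrom next o ∧ t'.toList.Perm (b :: t.toList) := by
  induction t with
  | nil => intro o _ ha; simp [toList] at ha
  | node v l r hl hr =>
    rintro o ⟨ho, h0, h1⟩ ha hb
    simp only [toList, List.mem_cons, List.mem_append, not_or] at ha hb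
    obtain ⟨hbv, hbl, hbr⟩ := hb
    rcases ha with rfl | ha | ha
    · have hempty : ∀ u : BTree α, u.HangsFrom next (some b) → b ∉ u.toList → u = nil := by
        rintro (_ | ⟨w, u₁, u₂⟩) hu hbu
        · rfl
        · have := hu.1
          simp only [Option.some.injEq] at this
          simp [toList, this] at hbu
      match i, hab with
      | 0, hab =>
        rw [hab] at h0
        obtain rfl := hempty l h0 hbl
        exact ⟨node a (node b nil nil) r, ⟨ho, ⟨hab, trivial, trivial⟩, h1⟩, by
          simpa [toList] using List.Perm.swap _ _ _⟩
      | 1, hab =>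
        rw [hab] at h1
        obtain rfl := hempty r h1 hbr
        exact ⟨node a l (node b nil nil), ⟨ho, h0, ⟨hab, trivial, trivial⟩⟩, by
          simpa [toList] using List.perm_append_comm (l₁ := a :: l.toList) (l₂ := [b])⟩
    · obtain ⟨l', hl', hp⟩ := hl h0 ha hbl
      refine ⟨node v l' r, ⟨ho, hl', h1⟩, ?_⟩
      simp only [toList]
      exact ((hp.append_right _).cons v).trans (List.Perm.swap _ _ _)
    · obtain ⟨r', hr', hp⟩ := hr h1 ha hbr
      refine ⟨node v l r', ⟨ho, h0, hr'⟩, ?_⟩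
      simp only [toList]
      refine ((hp.append_left _).cons v).trans ?_
      exact (List.perm_middle.cons v).trans (List.Perm.swap _ _ _)

/-- A prefix-free binary code for binary trees. -/
def encode : BTree Bool → List Bool
  | nil => [false]
  | node b l r => true :: b :: (l.encode ++ r.encode)

theorem length_encode (t : BTree Bool) : t.encode.length = 3 * t.toList.length + 1 := by
  induction t with
  | nil => rfl
  | node b l r hl hr => simp [encode, toList, hl, hr]; omega

theorem encode_append_inj (t : BTree Bool) : ∀ {t' : BTree Bool} {u u' : List Bool},
    t.encode ++ u = t'.encode ++ u' → t = t' ∧ u = u' := by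
  induction t with
  | nil =>
    rintro (_ | ⟨b', l', r'⟩) u u' h
    · simpa [encode] using h
    · simp [encode] at h
  | node b l r hl hr =>
    rintro (_ | ⟨b', l', r'⟩) u u' h
    · simp [encode] at h
    · simp only [encode, List.cons_append, List.append_assoc, List.cons.injEq, true_and] at h
      obtain ⟨h1, h2⟩ := hl h.2
      obtain ⟨h3, h4⟩ := hr h2
      exact ⟨by rw [h.1, h1, h3], h4⟩

theorem exists_finset_of_length_le (s : ℕ) :
    ∃ F : Finset (BTree Bool), (∀ t : BTree Bool, t.toList.length ≤ s → t ∈ F) ∧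
      F.card ≤ 2 ^ (3 * s + 1) := by
  classical
  -- Padding to a common length stays injective because the code is prefix-free.
  let pad : BTree Bool → List Bool := fun t =>
    t.encode ++ List.replicate (3 * s + 1 - t.encode.length) false
  have hpad : ∀ t : BTree Bool, t.toList.length ≤ s → (pad t).length = 3 * s + 1 := by
    intro t ht
    have := t.length_encode
    simp only [pad, List.length_append, List.length_replicate]
    omega
  let S : Set (BTree Bool) := {t | t.toList.length ≤ s}
  let f : S → List.Vector Bool (3 * s + 1) := fun t => ⟨pad t, hpad t t.2⟩
  have hf : Function.Injective f := by
    intro t t' h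
    have h' : pad t = pad t' := congrArg Subtype.val h
    exact Subtype.ext (encode_append_inj _ h').1
  have : Finite S := Finite.of_injective f hf
  have : Fintype S := Fintype.ofFinite S
  refine ⟨S.toFinset, fun t ht => by simpa [S] using ht, ?_⟩
  rw [Set.toFinset_card]
  simpa using Fintype.card_le_of_injective f hf

variable [DecidableEq α]

/-- The cells marked by a pattern laid out along the pointers, starting from `o`. -/
def marked (next : α → Fin 2 → Option α) : BTree Bool → Option α → Finset α
  | nil, _ => ∅
  | node _ _ _, none => ∅
  | node b l r, some v =>
    (if b then {v} else ∅) ∪ (l.marked next (next v 0) ∪ r.marked next (next v 1))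

/-- The Boolean shape alone recovers the marked cells, since the labels are dictated by the
pointers. Hence counting shapes bounds the number of marked sets near a cell. -/
theorem HangsFrom.marked_map {next : α → Fin 2 → Option α} (M : Finset α) (t : BTree α) :
    ∀ {o : Option α}, t.HangsFrom next o →
      (t.map fun v => decide (v ∈ M)).marked next o = t.toList.toFinset.filter (· ∈ M) := by
  induction t with
  | nil => intro o _; simp [map, marked, toList]
  | node v l r hl hr =>
    rintro o ⟨rfl, h0, h1⟩
    simp only [map, marked, hl h0, hr h1, toList, List.toFinset_cons, List.toFinset_append,
      Finset.filter_insert, Finset.filter_union]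
    by_cases hv : v ∈ M
    · simp [hv]
    · simp [hv]

/-- Cutting a tree into a residual tree with fewer than `k` marked cells, small pieces with at
least `k` marked cells, and few large pieces. -/
theorem HangsFrom.exists_pieces {next : α → Fin 2 → Option α} (M : Finset α) {k : ℕ} (hk : 0 < k)
    (s : ℕ) (t : BTree α) : ∀ {o : Option α}, t.HangsFrom next o → t.toList.Nodup →
      ∃ (u : BTree α) (G : Finset α) (b : ℕ), u.HangsFrom next o ∧ u.toList.Sublist t.toList ∧
        u.toList.countP (· ∈ M) < k ∧ (∀ v ∈ G, v ∈ t.toList) ∧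
        (∀ v ∈ G, ∃ p : BTree α, p.HangsFrom next (some v) ∧ p.toList.Nodup ∧
          p.toList.length ≤ s ∧ k ≤ p.toList.countP (· ∈ M)) ∧
        t.toList.countP (· ∈ M) ≤ u.toList.countP (· ∈ M) + 2 * k * (G.card + b) ∧
        s * b + u.toList.length ≤ t.toList.length := by
  induction t with
  | nil => exact fun _ _ => ⟨nil, ∅, 0, trivial, List.Sublist.refl _, by simpa [toList],
      by simp, by simp, by simp, by simp⟩
  | node v l r hl hr =>
    rintro o ⟨ho, h0, h1⟩ hnd
    have hnd' := hnd
    simp only [toList, List.nodup_cons, List.nodup_append, List.mem_append, not_or] at hnd'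
    obtain ⟨⟨hvl, hvr⟩, hndl, hndr, hdisj⟩ := hnd'
    obtain ⟨ul, Gl, bl, hul, hsl, hkl, hGl, hpl, hcl, hbl⟩ := hl h0 hndl
    obtain ⟨ur, Gr, br, hur, hsr, hkr, hGr, hpr, hcr, hbr⟩ := hr h1 hndr
    have hu : (node v ul ur).HangsFrom next o := ⟨ho, hul, hur⟩
    have hsub : (node v ul ur).toList.Sublist (node v l r).toList :=
      List.Sublist.cons_cons v (hsl.append hsr)
    have hGG : Disjoint Gl Gr := Finset.disjoint_left.2 fun x hx hx' =>
      hdisj x (hGl x hx) x (hGr x hx') rfl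
    have hcardG : (Gl ∪ Gr).card = Gl.card + Gr.card := Finset.card_union_of_disjoint hGG
    have hmem : ∀ x ∈ Gl ∪ Gr, x ∈ (node v l r).toList := by
      intro x hx
      simp only [toList, List.mem_cons, List.mem_append]
      rcases Finset.mem_union.1 hx with h | h
      · exact Or.inr (Or.inl (hGl x h))
      · exact Or.inr (Or.inr (hGr x h))
    have hpieces : ∀ w ∈ Gl ∪ Gr, ∃ p : BTree α, p.HangsFrom next (some w) ∧ p.toList.Nodup ∧
          p.toList.length ≤ s ∧ k ≤ p.toList.countP (· ∈ M) := by
      intro w hw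
      rcases Finset.mem_union.1 hw with h | h
      · exact hpl w h
      · exact hpr w h
    have hcount : ∀ l r : BTree α, (node v l r).toList.countP (· ∈ M) =
        l.toList.countP (· ∈ M) + r.toList.countP (· ∈ M) + if v ∈ M then 1 else 0 := by
      intro l r
      simp [toList, List.countP_cons]
    have hv1 : (if v ∈ M then 1 else 0) ≤ 1 := by split_ifs <;> simp
    have hlen : ∀ l r : BTree α, (node v l r).toList.length =
        l.toList.length + r.toList.length + 1 := by
      intro l r
      simp [toList]
    have hcA := hcount l r
    have hcB := hcount ul ur
    have hlA := hlen l r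
    have hlB := hlen ul ur
    have hnil : (nil : BTree α).toList = [] := rfl
    -- Both residual subtrees have fewer than `k` marks, so the joined tree has fewer than `2 * k`.
    -- It remains the residue, or is cut off here: as a small piece, identified by its top cell `v`
    -- in `G`, or as a large one, counted in `b` and paid for by its more than `s` cells.
    by_cases hkk : (node v ul ur).toList.countP (· ∈ M) < k
    · refine ⟨node v ul ur, Gl ∪ Gr, bl + br, hu, hsub, hkk, hmem, hpieces, ?_, ?_⟩
      · rw [hcardG]
        linarith
      · linarith
    · by_cases hs : (node v ul ur).toList.length ≤ s
      · have hvG : v ∉ Gl ∪ Gr := by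
          intro hv
          rcases Finset.mem_union.1 hv with h | h
          · exact hvl (hGl v h)
          · exact hvr (hGr v h)
        refine ⟨nil, insert v (Gl ∪ Gr), bl + br, trivial, List.nil_sublist _, by simpa [toList],
          ?_, ?_, ?_, ?_⟩
        · intro x hx
          rcases Finset.mem_insert.1 hx with rfl | hx
          · simp [toList]
          · exact hmem x hx
        · intro x hx
          rcases Finset.mem_insert.1 hx with rfl | hx
          · exact ⟨node x ul ur, ⟨rfl, hul, hur⟩, hsub.nodup hnd, hs, not_lt.1 hkk⟩
          · exact hpieces x hx
        · rw [Finset.card_insert_of_notMem hvG, hcardG, hnil, List.countP_nil]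
          linarith
        · rw [hnil, List.length_nil]
          linarith
      · refine ⟨nil, Gl ∪ Gr, bl + br + 1, trivial, List.nil_sublist _, by simpa [toList],
          hmem, hpieces, ?_, ?_⟩
        · rw [hcardG, hnil, List.countP_nil]
          linarith
        · rw [hnil, List.length_nil]
          linarith

end BTree

/-! ### Counting queries against small exploration trees -/

namespace PointerStructure

variable {U : Type*} (D : PointerStructure U)

theorem IsExplored.exists_tree {D : PointerStructure U} {V : Finset (Fin D.size)}
    (hV : D.IsExplored V) :
    ∃ t : BTree (Fin D.size), t.HangsFrom D.next (some D.root) ∧ t.toList.Nodup ∧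
      t.toList.toFinset = V := by
  classical
  -- A largest tree inside `V` that contains the root is closed under the pointers within `V`, since
  -- otherwise `exists_insert` enlarges it; hence it is all of `V`.
  let p : ℕ → Prop := fun k => ∃ t : BTree (Fin D.size), t.HangsFrom D.next (some D.root) ∧
    t.toList.Nodup ∧ D.root ∈ t.toList ∧ (∀ v ∈ t.toList, v ∈ V) ∧ t.toList.length = k
  have hp1 : p 1 := ⟨.node D.root .nil .nil, ⟨rfl, trivial, trivial⟩, by simp [BTree.toList],
    by simp [BTree.toList], by simpa [BTree.toList] using hV.1, by simp [BTree.toList]⟩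
  have hbound : ∀ k, p k → k ≤ V.card := by
    rintro k ⟨t, -, hnd, -, hsub, rfl⟩
    rw [← List.toFinset_card_of_nodup hnd]
    exact Finset.card_le_card fun v hv => hsub v (List.mem_toFinset.1 hv)
  have hmax := Nat.findGreatest_spec (P := p) (hbound 1 hp1) hp1
  set K := Nat.findGreatest p V.card with hK
  obtain ⟨t, ht, hnd, hroot, hsub, hlen⟩ := hmax
  refine ⟨t, ht, hnd, Finset.Subset.antisymm (fun v hv => hsub v (List.mem_toFinset.1 hv))
    fun v hv => List.mem_toFinset.2 ?_⟩
  refine Relation.ReflTransGen.head_induction_on (motive := fun a _ => a ∈ t.toList → v ∈ t.toList)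
    (hV.2 v hv) (fun h => h) ?_ hroot
  rintro a b ⟨-, hb, i, hi⟩ - ih ha
  refine ih ?_
  by_contra hbt
  obtain ⟨t', ht', hperm⟩ := BTree.HangsFrom.exists_insert hi t ht ha hbt
  have hp' : p (K + 1) := by
    refine ⟨t', ht', hperm.nodup_iff.2 (List.nodup_cons.2 ⟨hbt, hnd⟩),
      hperm.mem_iff.2 (List.mem_cons_of_mem _ hroot), fun v hv => ?_, ?_⟩
    · rcases List.mem_cons.1 (hperm.mem_iff.1 hv) with rfl | h
      · exact hb
      · exact hsub v h
    · rw [hperm.length_eq, List.length_cons, hlen]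
  have := Nat.le_findGreatest (hbound _ hp') hp'
  omega

/-- There are few sets of elements that can be collected near a given cell. -/
theorem exists_family [DecidableEq U] (s : ℕ) : ∃ F : Fin D.size → Finset (Finset U),
    (∀ v, (F v).card ≤ 2 ^ (3 * s + 1)) ∧
    ∀ v (t : BTree (Fin D.size)), t.HangsFrom D.next (some v) → t.toList.length ≤ s →
      ∀ M : Finset (Fin D.size),
        ((t.toList.toFinset.filter (· ∈ M)).image D.elem).eraseNone ∈ F v := by
  obtain ⟨T, hT, hcard⟩ := BTree.exists_finset_of_length_le s
  refine ⟨fun v => T.image fun p => ((p.marked D.next (some v)).image D.elem).eraseNone,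
    fun v => Finset.card_image_le.trans hcard, fun v t ht hs M => ?_⟩
  refine Finset.mem_image.2 ⟨t.map fun v => decide (v ∈ M), hT _ ?_, ?_⟩
  · rwa [BTree.length_toList_map]
  · rw [ht.marked_map M t]

/-- One cell is marked per reported element, so that marked cells and elements of the answer
correspond bijectively and cells can be counted in place of elements. -/
theorem ReportsWithin.exists_marks {D : PointerStructure U} [DecidableEq U] {A : Finset U} {T : ℝ}
    {n : ℕ} (h : D.ReportsWithin A T) (hT : T ≤ n) :
    ∃ (t : BTree (Fin D.size)) (M : Finset (Fin D.size)), t.HangsFrom D.next (some D.root) ∧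
      t.toList.Nodup ∧ t.toList.length ≤ n ∧ M ⊆ t.toList.toFinset ∧ M.card = A.card ∧
      ∀ Y ⊆ M, (Y.image D.elem).eraseNone ⊆ A ∧ (Y.image D.elem).eraseNone.card = Y.card := by
  classical
  obtain ⟨V, hV, hVT, hA⟩ := h
  obtain ⟨t, ht, hnd, rfl⟩ := hV.exists_tree
  have : Nonempty (Fin D.size) := ⟨D.root⟩
  choose! f hf using hA
  have hinj : Set.InjOn f A := by
    intro x hx y hy hxy
    have h1 := (hf x hx).2
    rw [hxy, (hf y hy).2] at h1
    exact (Option.some.inj h1).symm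
  refine ⟨t, A.image f, ht, hnd, ?_, ?_, Finset.card_image_of_injOn hinj, fun Y hY => ?_⟩
  · rw [List.toFinset_card_of_nodup hnd] at hVT
    exact_mod_cast hVT.trans hT
  · intro v hv
    obtain ⟨x, hx, rfl⟩ := Finset.mem_image.1 hv
    exact (hf x hx).1
  · obtain ⟨Z, hZ, rfl⟩ := Finset.subset_image_iff.1 hY
    have hZA : ∀ x ∈ Z, x ∈ A := fun x hx => hZ hx
    have : (((Z.image f).image D.elem).eraseNone) = Z := by
      ext x
      simp only [Finset.mem_eraseNone, Finset.mem_image, exists_exists_and_eq_and]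
      constructor
      · rintro ⟨y, hy, hyx⟩
        rw [(hf y (hZA y hy)).2] at hyx
        exact Option.some.inj hyx ▸ hy
      · exact fun hx => ⟨x, hx, (hf x (hZA x hx)).2⟩
    rw [this]
    exact ⟨hZA, (Finset.card_image_of_injOn (hinj.mono hZ)).symm⟩

/-- Sets near cells, each in few answers: a bound for the number of incidences. -/
theorem card_incidences_le {ι V : Type*} [DecidableEq ι] [DecidableEq V] [DecidableEq U]
    {β ℓ L : ℕ} (ans : ι → Finset U)
    (hans : ∀ X : Finset U, β ≤ X.card → ∀ I : Finset ι, (∀ q ∈ I, X ⊆ ans q) → I.card ≤ ℓ)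
    (F : V → Finset (Finset U)) (hF : ∀ v, (F v).card ≤ L) (W : Finset V) (I : Finset (ι × V))
    (hI : ∀ p ∈ I, p.2 ∈ W ∧ ∃ X ∈ F p.2, X ⊆ ans p.1 ∧ β ≤ X.card) :
    I.card ≤ ℓ * (W.card * L) := by
  choose! hW X hX hXans hXβ using hI
  have hmaps : ∀ p ∈ I, (⟨p.2, X p⟩ : Σ _ : V, Finset U) ∈ W.sigma F := fun p hp =>
    Finset.mem_sigma.2 ⟨hW p hp, hX p hp⟩
  refine (Finset.card_le_mul_card_image_of_maps_to hmaps ℓ ?_).trans ?_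
  · rintro ⟨v, Y⟩ -
    rcases (I.filter fun p => (⟨p.2, X p⟩ : Σ _ : V, Finset U) = ⟨v, Y⟩).eq_empty_or_nonempty
      with he | ⟨p₀, hp₀⟩
    · rw [he]
      exact Nat.zero_le _
    have hmem : ∀ p ∈ I.filter fun p => (⟨p.2, X p⟩ : Σ _ : V, Finset U) = ⟨v, Y⟩,
        p ∈ I ∧ p.2 = v ∧ X p = Y := by
      intro p hp
      obtain ⟨h1, h2⟩ := Finset.mem_filter.1 hp
      simp only [Sigma.mk.injEq, heq_eq_eq] at h2
      exact ⟨h1, h2⟩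
    have hinj : Set.InjOn Prod.fst (↑(I.filter fun p =>
        (⟨p.2, X p⟩ : Σ _ : V, Finset U) = ⟨v, Y⟩) : Set (ι × V)) := fun p hp p' hp' h =>
      Prod.ext h ((hmem p hp).2.1.trans (hmem p' hp').2.1.symm)
    rw [← Finset.card_image_of_injOn hinj]
    refine hans Y ?_ _ fun q hq => ?_
    · obtain ⟨h1, -, h2⟩ := hmem p₀ hp₀
      exact h2 ▸ hXβ p₀ h1
    · obtain ⟨p, hp, rfl⟩ := Finset.mem_image.1 hq
      obtain ⟨h1, -, h2⟩ := hmem p hp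
      exact h2 ▸ hXans p h1
  · rw [Finset.card_sigma]
    gcongr
    calc ∑ v ∈ W, (F v).card ≤ ∑ _v ∈ W, L := Finset.sum_le_sum fun v _ => hF v
      _ = W.card * L := by simp

/-- Few answers can be reported quickly, because few sets of cells can be explored quickly. -/
theorem card_queries_le {ι : Type*} [Fintype ι] {β ℓ n : ℕ}
    (ans : ι → Finset U)
    (hans : ∀ X : Finset U, β ≤ X.card → ∀ I : Finset ι, (∀ q ∈ I, X ⊆ ans q) → I.card ≤ ℓ)
    (hβ : ∀ q, β ≤ (ans q).card) {T : ι → ℝ} (hT : ∀ q, T q ≤ n)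
    (h : ∀ q, D.ReportsWithin (ans q) (T q)) :
    Fintype.card ι ≤ ℓ * 2 ^ (3 * n + 1) := by
  classical
  obtain ⟨F, hF, hF'⟩ := D.exists_family n
  -- Every exploration starts at the root, so the root is the only top cell and the space drops out
  -- of the bound.
  have := card_incidences_le ans hans F hF {D.root} (Finset.univ ×ˢ {D.root}) (by
    rintro ⟨q, v⟩ hp
    have hv : v = D.root := by simpa [eq_comm] using hp
    subst hv
    refine ⟨by simp, ?_⟩
    obtain ⟨t, M, ht, hnd, hlen, hM, hMA, hY⟩ := (h q).exists_marks (hT q)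
    have hfil : t.toList.toFinset.filter (· ∈ M) = M := by
      rw [Finset.filter_mem_eq_inter, Finset.inter_eq_right.2 hM]
    have h1 := hF' D.root t ht hlen M
    rw [hfil] at h1
    have h2 := hY M subset_rfl
    exact ⟨_, h1, h2.1, by rw [h2.2, hMA]; exact hβ q⟩)
  simpa [Finset.card_product] using this

/-- The space needed to report answers that have few common elements. -/
theorem card_mul_le_size {ι : Type*} [Fintype ι] {β ℓ n s B g : ℕ}
    (ans : ι → Finset U)
    (hans : ∀ X : Finset U, β ≤ X.card → ∀ I : Finset ι, (∀ q ∈ I, X ⊆ ans q) → I.card ≤ ℓ)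
    (hβ : 0 < β) (hB : ∀ q, (ans q).card = B) {T : ι → ℝ} (hT : ∀ q, T q ≤ n)
    (h : ∀ q, D.ReportsWithin (ans q) (T q))
    (hg : ∀ x b : ℕ, B ≤ β + 2 * β * (x + b) → s * b ≤ n → g ≤ x) :
    Fintype.card ι * g ≤ ℓ * (D.size * 2 ^ (3 * s + 1)) := by
  classical
  obtain ⟨F, hF, hF'⟩ := D.exists_family s
  have key : ∀ q, ∃ G : Finset (Fin D.size), g ≤ G.card ∧
      ∀ v ∈ G, ∃ X ∈ F v, X ⊆ ans q ∧ β ≤ X.card := by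
    intro q
    obtain ⟨t, M, ht, hnd, hlen, hM, hMA, hY⟩ := (h q).exists_marks (hT q)
    obtain ⟨u, G, b, -, -, hu, -, hp, hc, hs⟩ := ht.exists_pieces M hβ s t hnd
    have hcount : ∀ u : BTree (Fin D.size), u.toList.Nodup →
        u.toList.countP (· ∈ M) = (u.toList.toFinset.filter (· ∈ M)).card := by
      intro u hu
      rw [List.countP_eq_length_filter, ← List.toFinset_card_of_nodup (hu.filter _),
        List.toFinset_filter]
      simp
    have hfil : t.toList.toFinset.filter (· ∈ M) = M := by
      rw [Finset.filter_mem_eq_inter, Finset.inter_eq_right.2 hM]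
    rw [hcount t hnd, hfil, hMA, hB] at hc
    refine ⟨G, hg G.card b (by omega) (by omega), fun v hv => ?_⟩
    obtain ⟨p, hp1, hp2, hp3, hp4⟩ := hp v hv
    have h2 := hY (p.toList.toFinset.filter (· ∈ M)) fun x hx => (Finset.mem_filter.1 hx).2
    refine ⟨_, hF' v p hp1 hp3 M, h2.1, ?_⟩
    rw [h2.2, ← hcount p hp2]
    exact hp4
  choose G hG hG' using key
  have := card_incidences_le ans hans F hF Finset.univ
    ((Finset.univ.sigma G).map (Equiv.sigmaEquivProd _ _).toEmbedding) (by
      intro p hp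
      obtain ⟨x, hx, rfl⟩ := Finset.mem_map.1 hp
      exact ⟨Finset.mem_univ _, hG' x.1 x.2 (Finset.mem_sigma.1 hx).2⟩)
  rw [Finset.card_map, Finset.card_sigma, Finset.card_univ, Fintype.card_fin] at this
  calc Fintype.card ι * g = ∑ _q : ι, g := by simp
    _ ≤ ∑ q, (G q).card := Finset.sum_le_sum fun q _ => hG q
    _ ≤ _ := this

/-- Applied to the query that returns all points, this settles the case `d = 1`, where `d / 2`
vanishes. -/
theorem card_le_size {A : Finset U} {T : ℝ} (h : D.ReportsWithin A T) : A.card ≤ D.size := by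
  classical
  obtain ⟨t, M, -, -, -, -, hMA, -⟩ := h.exists_marks (Nat.le_ceil T)
  rw [← hMA]
  simpa using Finset.card_le_univ M

end PointerStructure

/-! ### The semigroup model -/

theorem nsmul_coe_ne_zero {G : Type*} [AddCommSemigroup G] (g : G) {n : ℕ} (hn : 0 < n) :
    n • (g : WithZero G) ≠ 0 := by
  induction n, hn using Nat.le_induction with
  | base => simp
  | succ n _ ih =>
    rw [succ_nsmul]
    obtain ⟨a, ha⟩ := WithZero.ne_zero_iff_exists.1 ih
    rw [← ha, ← WithZero.coe_add]
    exact WithZero.coe_ne_zero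

theorem linForm_ne_zero {U G : Type*} [AddCommSemigroup G] (w : U → G) {I : Finset U}
    (hI : I.Nonempty) (a : U → ℕ) (ha : ∀ x ∈ I, 0 < a x) : linForm w I a ≠ 0 := by
  classical
  induction hI using Finset.Nonempty.cons_induction with
  | singleton x => simpa [linForm] using nsmul_coe_ne_zero (w x) (ha x (by simp))
  | cons x I hx hI ih =>
    have h1 := nsmul_coe_ne_zero (w x) (ha x (by simp))
    have h2 := ih fun y hy => ha y (by simp [hy])
    obtain ⟨b, hb⟩ := WithZero.ne_zero_iff_exists.1 h1
    obtain ⟨c, hc⟩ := WithZero.ne_zero_iff_exists.1 h2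
    rw [linForm, Finset.sum_cons, ← hb]
    change (b : WithZero G) + linForm w I a ≠ 0
    rw [← hc, ← WithZero.coe_add]
    exact WithZero.coe_ne_zero

theorem exists_injOn_nat {U : Type*} (J : Finset U) : ∃ e : U → ℕ, Set.InjOn e J := by
  classical
  refine ⟨fun x => if h : x ∈ J then J.equivFin ⟨x, h⟩ else 0, fun x hx y hy h => ?_⟩
  simp only [Finset.mem_coe] at hx hy
  simp only [hx, hy, dif_pos] at h
  exact congrArg Subtype.val (J.equivFin.injective (Fin.ext h))

theorem linForm_image_invFunOn {U V G : Type*} [AddCommSemigroup G] [DecidableEq V] [Nonempty U]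
    {e : U → V} {I S : Finset U} (he : Set.InjOn e S) (hI : I ⊆ S) (g : V → G) (a : U → ℕ) :
    linForm g (I.image e) (fun n => a (Function.invFunOn e S n)) =
      linForm (fun x => g (e x)) I a := by
  rw [linForm, Finset.sum_image (he.mono hI)]
  refine Finset.sum_congr rfl fun x hx => ?_
  rw [he.leftInvOn_invFunOn (hI hx)]

/-- Over an empty semigroup the identity of forms holds vacuously, which would give `{0} = {1}`. -/
theorem FaithfulSemigroup.nonempty {G : Type*} [AddCommSemigroup G] (h : FaithfulSemigroup G) :
    Nonempty G := by
  by_contra hG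
  have := h {0} {1} (by simp) (by simp) (fun _ => 1) (fun _ => 1) (by simp) (by simp)
    fun g => (hG ⟨g 0⟩).elim
  simp at this

theorem AdaptivelyFaithfulSemigroup.nonempty {G : Type*} [AddCommSemigroup G]
    (h : AdaptivelyFaithfulSemigroup G) : Nonempty G := by
  by_contra hG
  have := h {0} {1} (by simp) (by simp) fun g => (hG ⟨g 0⟩).elim
  simp at this

/-! ### Faithfulness forces the picked supports to cover the answer exactly -/

namespace SumScheme

variable {U Q : Type*} {D : SumScheme U Q}

theorem sum_linForm [DecidableEq U] {G : Type*} [AddCommSemigroup G] (w : U → G)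
    (J : Finset (Fin D.size))
    (mult : Fin D.size → ℕ) (coef : Fin D.size → U → ℕ) :
    ∑ i ∈ J, mult i • linForm w (D.supp i) (coef i) = linForm w (J.biUnion D.supp)
      fun x => ∑ i ∈ J, if x ∈ D.supp i then mult i * coef i x else 0 := by
  have h : ∀ i ∈ J, mult i • linForm w (D.supp i) (coef i) =
      ∑ x ∈ J.biUnion D.supp,
        (if x ∈ D.supp i then mult i * coef i x else 0) • (w x : WithZero G) := by
    intro i hi
    have hsub : D.supp i ⊆ J.biUnion D.supp := Finset.subset_biUnion_of_mem D.supp hi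
    rw [← Finset.sum_subset hsub (fun x _ hx => by simp [hx])]
    rw [linForm, Finset.smul_sum]
    exact Finset.sum_congr rfl fun x hx => by rw [if_pos hx, mul_nsmul']
  rw [Finset.sum_congr rfl h, Finset.sum_comm]
  exact Finset.sum_congr rfl fun x _ => Finset.sum_nsmul_assoc J _ (w x : WithZero G)

theorem coef_pos [DecidableEq U] {J : Finset (Fin D.size)} {mult : Fin D.size → ℕ}
    {coef : Fin D.size → U → ℕ} (h1 : ∀ i, ∀ x ∈ D.supp i, 0 < coef i x) (h2 : ∀ i ∈ J, 0 < mult i) :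
    ∀ x ∈ J.biUnion D.supp, 0 < ∑ i ∈ J, if x ∈ D.supp i then mult i * coef i x else 0 := by
  intro x hx
  obtain ⟨i, hi, hxi⟩ := Finset.mem_biUnion.1 hx
  refine Finset.sum_pos' (fun _ _ => Nat.zero_le _) ⟨i, hi, ?_⟩
  rw [if_pos hxi]
  exact Nat.mul_pos (h2 i hi) (h1 i x hxi)

/-- The form over the empty set is the adjoined zero, which no nonempty form with positive
coefficients attains. -/
theorem nonempty_of_linForm_eq {U G : Type*} [AddCommSemigroup G] [Nonempty G] {A K : Finset U}
    (hA : A.Nonempty)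
    (h : ∀ w : U → G, ∃ a : U → ℕ, linForm w A (fun _ => 1) = linForm w K a) : K.Nonempty := by
  obtain ⟨g⟩ := ‹Nonempty G›
  obtain ⟨a, ha⟩ := h fun _ => g
  by_contra hK
  rw [Finset.not_nonempty_iff_eq_empty.1 hK] at ha
  exact linForm_ne_zero (fun _ => g) hA (fun _ => 1) (by simp) (by simpa [linForm] using ha)

/-- The combination of picked sums is a single form on the union of their supports, with positive
coefficients, so no variable cancels and faithfulness applies. -/
theorem Solves.biUnion_eq [DecidableEq U] {G : Type*} [AddCommSemigroup G] (hG : FaithfulSemigroup G)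
    {ans : Q → Finset U} (h : D.Solves G ans) {q : Q} (hq : (ans q).Nonempty) :
    (D.pick q).biUnion D.supp = ans q := by
  have := hG.nonempty
  have : Nonempty U := ⟨hq.choose⟩
  obtain ⟨coef, mult, hD⟩ := h
  obtain ⟨w₀⟩ : Nonempty (U → G) := inferInstance
  obtain ⟨a, hpos, heq⟩ : ∃ a : U → ℕ, (∀ x ∈ (D.pick q).biUnion D.supp, 0 < a x) ∧
      ∀ w : U → G, linForm w (ans q) (fun _ => 1) = linForm w ((D.pick q).biUnion D.supp) a :=
    ⟨_, coef_pos (hD w₀).1 ((hD w₀).2.1 q),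
      fun w => ((hD w).2.2 q).trans (sum_linForm w (D.pick q) (mult q) coef)⟩
  have hK := nonempty_of_linForm_eq hq fun w => ⟨a, heq w⟩
  -- Faithfulness speaks of variables indexed by `ℕ`, so the finitely many elements involved are
  -- renamed injectively.
  obtain ⟨e, he⟩ := exists_injOn_nat (ans q ∪ (D.pick q).biUnion D.supp)
  have key := hG ((ans q).image e) (((D.pick q).biUnion D.supp).image e) (hq.image e) (hK.image e)
    (fun _ => 1) (fun n => a (Function.invFunOn e ↑(ans q ∪ (D.pick q).biUnion D.supp) n)) (by simp)
    (fun n hn => by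
      obtain ⟨x, hx, rfl⟩ := Finset.mem_image.1 hn
      exact hpos _ (by rwa [he.leftInvOn_invFunOn (Finset.mem_union_right _ hx)])) fun g => by
    rw [linForm_image_invFunOn he Finset.subset_union_right, ← heq]
    exact linForm_image_invFunOn he Finset.subset_union_left g fun _ => 1
  exact (Finset.image_injOn_powerset_of_injOn he
    (Finset.mem_coe.2 (Finset.mem_powerset.2 Finset.subset_union_left))
    (Finset.mem_coe.2 (Finset.mem_powerset.2 Finset.subset_union_right)) key).symm

theorem SolvesAdaptively.biUnion_eq [DecidableEq U] {G : Type*} [AddCommSemigroup G]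
    (hG : AdaptivelyFaithfulSemigroup G)
    {ans : Q → Finset U} (h : D.SolvesAdaptively G ans) {q : Q} (hq : (ans q).Nonempty) :
    (D.pick q).biUnion D.supp = ans q := by
  have := hG.nonempty
  have : Nonempty U := ⟨hq.choose⟩
  have heq : ∀ w : U → G, ∃ a : U → ℕ, (∀ x ∈ (D.pick q).biUnion D.supp, 0 < a x) ∧
      linForm w (ans q) (fun _ => 1) = linForm w ((D.pick q).biUnion D.supp) a := by
    intro w
    obtain ⟨coef, mult, h1, h2, h3⟩ := h w
    exact ⟨_, coef_pos h1 (h2 q), (h3 q).trans (sum_linForm w (D.pick q) (mult q) coef)⟩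
  have hK := nonempty_of_linForm_eq hq fun w => (heq w).imp fun _ ha => ha.2
  obtain ⟨e, he⟩ := exists_injOn_nat (ans q ∪ (D.pick q).biUnion D.supp)
  have key := hG ((ans q).image e) (((D.pick q).biUnion D.supp).image e) (hq.image e)
    (hK.image e) fun g => by
    obtain ⟨a, ha, hw⟩ := heq fun x => g (e x)
    refine ⟨fun n => a (Function.invFunOn e ↑(ans q ∪ (D.pick q).biUnion D.supp) n),
      fun n hn => ?_, ?_⟩
    · obtain ⟨x, hx, rfl⟩ := Finset.mem_image.1 hn
      exact ha _ (by rwa [he.leftInvOn_invFunOn (Finset.mem_union_right _ hx)])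
    · rw [linForm_image_invFunOn he Finset.subset_union_right, ← hw]
      exact linForm_image_invFunOn he Finset.subset_union_left g fun _ => 1
  exact (Finset.image_injOn_powerset_of_injOn he
    (Finset.mem_coe.2 (Finset.mem_powerset.2 Finset.subset_union_left))
    (Finset.mem_coe.2 (Finset.mem_powerset.2 Finset.subset_union_right)) key).symm

/-- Pigeonhole twice: supports with fewer than `β` elements are too few to cover an answer, so each
query has a support with at least `β`; and each support is charged by at most `ℓ` queries. -/
theorem card_le_mul_size {ι : Type*} [Fintype ι] (D : SumScheme U Q) {β ℓ : ℕ} (Qs : ι → Q)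
    (ans : Q → Finset U)
    (hans : ∀ X : Finset U, β ≤ X.card → ∀ I : Finset ι, (∀ t ∈ I, X ⊆ ans (Qs t)) → I.card ≤ ℓ)
    (hD : ∀ t, ∀ x ∈ ans (Qs t), ∃ i ∈ D.pick (Qs t), x ∈ D.supp i ∧ D.supp i ⊆ ans (Qs t))
    (hT : ∀ t, (D.pick (Qs t)).card * (β - 1) < (ans (Qs t)).card) :
    Fintype.card ι ≤ ℓ * D.size := by
  classical
  have key : ∀ t, ∃ i, D.supp i ⊆ ans (Qs t) ∧ β ≤ (D.supp i).card := by
    intro t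
    by_contra! hcon
    let J := (D.pick (Qs t)).filter fun i => D.supp i ⊆ ans (Qs t)
    have hsub : ans (Qs t) ⊆ J.biUnion D.supp := by
      intro x hx
      obtain ⟨i, hi, hxi, hs⟩ := hD t x hx
      exact Finset.mem_biUnion.2 ⟨i, Finset.mem_filter.2 ⟨hi, hs⟩, hxi⟩
    have h1 : (ans (Qs t)).card ≤ J.card * (β - 1) :=
      (Finset.card_le_card hsub).trans <| Finset.card_biUnion_le_card_mul _ _ _ fun i hi => by
        have := hcon i (Finset.mem_filter.1 hi).2
        omega
    have h2 : J.card ≤ (D.pick (Qs t)).card := Finset.card_filter_le _ _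
    have := Nat.mul_le_mul_right (β - 1) h2
    have := hT t
    omega
  choose f hf using key
  have := Finset.card_le_mul_card_image_of_maps_to (s := Finset.univ) (t := Finset.univ) (f := f)
    (fun _ _ => Finset.mem_univ _) ℓ fun i _ => by
      rcases (Finset.univ.filter fun t => f t = i).eq_empty_or_nonempty with he | ⟨t₀, ht₀⟩
      · simp [he]
      · have h0 := (Finset.mem_filter.1 ht₀).2
        refine hans (D.supp i) (h0 ▸ (hf t₀).2) _ fun t ht => ?_
        have h1 := (Finset.mem_filter.1 ht).2
        exact h1 ▸ (hf t).1
  simpa using this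

end SumScheme

/-! ### Space bounds for given numbers of points and dimensions -/

theorem sq_half_le_two_pow (d : ℕ) : (d / 2) ^ 2 ≤ 2 ^ (2 * Nat.log 2 d) := by
  have h1 : d < 2 ^ (Nat.log 2 d + 1) := Nat.lt_pow_succ_log_self one_lt_two d
  have h2 : d / 2 ≤ 2 ^ Nat.log 2 d := by
    rw [pow_succ] at h1
    omega
  calc (d / 2) ^ 2 ≤ (2 ^ Nat.log 2 d) ^ 2 := Nat.pow_le_pow_left h2 2
    _ = 2 ^ (2 * Nat.log 2 d) := by ring

theorem sq_lt_pow_of_le {m k N : ℕ} (hk : k ≤ m) (hN : 2 ≤ N) :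
    k ^ 2 < N ^ (2 * Nat.log 2 m + 3) := by
  have h1 : m < 2 ^ (Nat.log 2 m + 1) := Nat.lt_pow_succ_log_self one_lt_two m
  calc k ^ 2 < (2 ^ (Nat.log 2 m + 1)) ^ 2 := Nat.pow_lt_pow_left (hk.trans_lt h1) two_ne_zero
    _ = 2 ^ (2 * Nat.log 2 m + 2) := by ring
    _ ≤ 2 ^ (2 * Nat.log 2 m + 3) := Nat.pow_le_pow_right two_pos (by omega)
    _ ≤ N ^ (2 * Nat.log 2 m + 3) := Nat.pow_le_pow_left hN _

/-- A binary alphabet suffices here: `β` is about `2 * log d`, and the loss `r ^ 2` is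
polylogarithmic in `m`. -/
theorem exists_points_searching.{u} {m d : ℕ} (hd : 1 ≤ d) (hm : 4 ≤ m) :
    ∃ P : Finset (Fin d → ℝ), P.card = m ∧
      ∀ (G : Type u) [AddCommSemigroup G] (D : SumScheme (Fin d → ℝ) (TwoSidedQuery d)),
        (FaithfulSemigroup G ∧ D.Solves G (fun q => q.answer P)) ∨
          (AdaptivelyFaithfulSemigroup G ∧ D.SolvesAdaptively G (fun q => q.answer P)) →
        (∀ q : TwoSidedQuery d, (D.pick q).card * (2 * Nat.log 2 d) < m / 4) →
        (d / 2) ^ 2 ≤ (2 * Nat.log 2 m + 3) ^ 2 * D.size ∧ 1 ≤ D.size := by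
  classical
  obtain ⟨P, hP, ⟨q₀, hq₀⟩, Q, hB, hX⟩ :=
    exists_hard_instance (m := m) (d := d) (h := d / 2) (B := m / 4) (N := 2)
      (β := 2 * Nat.log 2 d + 1) (r := 2 * Nat.log 2 m + 3) hd (by omega) (by omega) two_pos
      (by omega)
      ((sq_half_le_two_pow d).trans (Nat.pow_le_pow_right two_pos (by omega)))
      (sq_lt_pow_of_le (by omega) le_rfl)
  refine ⟨P, hP, fun G _ D hD hT => ?_⟩
  have hU : ∀ q : TwoSidedQuery d, (q.answer P).Nonempty →
      (D.pick q).biUnion D.supp = q.answer P := by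
    intro q hq
    rcases hD with ⟨hG, h⟩ | ⟨hG, h⟩
    · exact h.biUnion_eq hG (q := q) hq
    · exact h.biUnion_eq hG (q := q) hq
  constructor
  · have := D.card_le_mul_size Q (fun q => q.answer P) hX (fun t x hx => ?_) fun t => ?_
    · simpa [sq] using this
    · have h := hU (Q t) ⟨x, hx⟩
      rw [← h] at hx
      obtain ⟨i, hi, hxi⟩ := Finset.mem_biUnion.1 hx
      exact ⟨i, hi, hxi, h ▸ Finset.subset_biUnion_of_mem D.supp hi⟩
    · simpa [hB] using hT (Q t)
  · have hne : (q₀.answer P).Nonempty := by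
      rw [hq₀, ← Finset.card_pos]
      omega
    obtain ⟨x, hx⟩ := hne
    rw [← hU q₀ ⟨x, hx⟩] at hx
    obtain ⟨i, -⟩ := Finset.mem_biUnion.1 hx
    exact i.pos

theorem cube_le_two_pow {k : ℕ} (hk : 10 ≤ k) : k ^ 3 ≤ 2 ^ k := by
  induction k, hk using Nat.le_induction with
  | base => norm_num
  | succ k hk ih =>
    have h1 : (k + 1) ^ 3 ≤ 2 * k ^ 3 := by nlinarith [sq_nonneg k]
    calc (k + 1) ^ 3 ≤ 2 * k ^ 3 := h1
      _ ≤ 2 * 2 ^ k := Nat.mul_le_mul_left _ ih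
      _ = 2 ^ (k + 1) := by ring

/-- In the case `B < 2 * β` the queries cannot be answered at all. -/
theorem exists_points_reporting {m d a : ℕ} (hd : 1 ≤ d) (ha : 1 ≤ a)
    (hL : 16 * a + 16 ≤ Nat.log 2 (Nat.log 2 m)) :
    ∃ P : Finset (Fin d → ℝ), P.card = m ∧
      ∀ (D : PointerStructure (Fin d → ℝ)) (T : TwoSidedQuery d → ℝ),
        (∀ q, D.ReportsWithin (q.answer P) (T q)) →
        (∀ q, (q.answer P).card = m / Nat.log 2 m ^ 2 →
          T q ≤ (a * (m / Nat.log 2 m ^ 2) : ℕ)) →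
        m ≤ D.size ∧
        ∃ β, β = 2 * Nat.log 2 d / Nat.log 2 (Nat.log 2 m) + 1 ∧ 2 * β ≤ m / Nat.log 2 m ^ 2 ∧
          (d / 2) ^ 2 * (m / Nat.log 2 m ^ 2) ≤
            8 * β * ((2 * Nat.log 2 m + 3) ^ 2 * (D.size * 2 ^ (24 * a * β + 1))) := by
  set k := Nat.log 2 m with hk
  set L := Nat.log 2 k with hL'
  set B := m / k ^ 2 with hB'
  set e := Nat.log 2 d with he
  have hk0 : k ≠ 0 := by
    rintro h
    rw [h] at hL'
    simp at hL'
    omega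
  have hm0 : m ≠ 0 := by
    rintro rfl
    exact hk0 (by simp [hk])
  have hNk : 2 ^ L ≤ k := Nat.pow_log_le_self 2 hk0
  have hk10 : 10 ≤ k := by
    have : L < 2 ^ L := Nat.lt_two_pow_self
    omega
  have hkm : 2 ^ k ≤ m := Nat.pow_log_le_self 2 hm0
  have hN2 : 2 ≤ 2 ^ L := by
    calc 2 = 2 ^ 1 := rfl
      _ ≤ 2 ^ L := Nat.pow_le_pow_right two_pos (by omega)
  have hBN : B * (2 ^ L) ^ 2 ≤ m :=
    (Nat.mul_le_mul_left _ (Nat.pow_le_pow_left hNk 2)).trans (Nat.div_mul_le_self m (k ^ 2))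
  have hBN' : B * 2 ^ L ≤ m :=
    (Nat.mul_le_mul_left _ (Nat.le_self_pow two_ne_zero _)).trans hBN
  have hkB : k ≤ B := by
    rw [hB', Nat.le_div_iff_mul_le (by positivity)]
    calc k * k ^ 2 = k ^ 3 := by ring
      _ ≤ 2 ^ k := cube_le_two_pow hk10
      _ ≤ m := hkm
  have hLβ : ∀ β, β = 2 * e / L + 1 → 2 * e ≤ L * β := by
    rintro β rfl
    exact (Nat.lt_mul_div_succ _ (by omega)).le
  -- `β` is chosen with `h ^ 2 ≤ N ^ β`. Cutting into pieces needs answers of at least `2 * β`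
  -- points.
  by_cases hβB : 2 * (2 * e / L + 1) ≤ B
  · obtain ⟨β, hβ⟩ : ∃ β, β = 2 * e / L + 1 := ⟨_, rfl⟩
    have hβ0 : 0 < β := hβ ▸ Nat.succ_pos _
    obtain ⟨P, hP, ⟨q₀, hq₀⟩, Q, hB, hX⟩ :=
      exists_hard_instance (m := m) (d := d) (h := d / 2) (B := B) (N := 2 ^ L)
        (β := β) (r := 2 * k + 3) hd (by omega) hβ0 (by positivity) hBN
        ((sq_half_le_two_pow d).trans (by
          rw [← pow_mul]
          exact Nat.pow_le_pow_right two_pos (hLβ β hβ)))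
        (sq_lt_pow_of_le hBN' hN2)
    refine ⟨P, hP, fun D T hD hT => ⟨?_, β, hβ, hβ ▸ hβB, ?_⟩⟩
    · rw [← hP]
      exact D.card_le_size (hq₀ ▸ hD q₀)
    · have hdiv : B ≤ 8 * β * ((B + (8 * β - 1)) / (8 * β)) := by
        have := Nat.lt_mul_div_succ (B + (8 * β - 1)) (b := 8 * β) (by omega)
        rw [mul_add] at this
        omega
      -- With `s = 8 * a * β`, large pieces number at most `B / (8 * β)` and hold at most `B / 4`
      -- marks. The residue holds at most `B / 2`, so small pieces must carry the remaining quarter: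
      -- `B ≤ 8 * β * x`.
      have := D.card_mul_le_size (s := 8 * a * β) (n := a * B) (B := B)
        (g := (B + (8 * β - 1)) / (8 * β)) (fun t => (Q t).answer P) hX hβ0 hB
        (T := fun t => T (Q t)) (fun t => hT _ (hB t)) (fun t => hD _) (fun x b h1 h2 => by
          have h3 : 8 * β * b ≤ B := by
            refine Nat.le_of_mul_le_mul_left ?_ ha
            calc a * (8 * β * b) = 8 * a * β * b := by ring
              _ ≤ a * B := h2
          have h4 : 2 * β ≤ B := hβ ▸ hβB
          have h5 : B ≤ 8 * β * x := by nlinarith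
          refine Nat.lt_succ_iff.1 (Nat.div_lt_of_lt_mul ?_)
          rw [Nat.mul_succ]
          omega)
      simp only [Fintype.card_prod, Fintype.card_fin] at this
      calc (d / 2) ^ 2 * B ≤ (d / 2) ^ 2 * (8 * β * ((B + (8 * β - 1)) / (8 * β))) :=
            Nat.mul_le_mul_left _ hdiv
        _ = 8 * β * (d / 2 * (d / 2) * ((B + (8 * β - 1)) / (8 * β))) := by ring
        _ ≤ 8 * β * ((2 * k + 3) ^ 2 * (D.size * 2 ^ (3 * (8 * a * β) + 1))) :=
            Nat.mul_le_mul_left _ this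
        _ = _ := by rw [show 3 * (8 * a * β) = 24 * a * β by ring]
  · obtain ⟨β, hβ⟩ : ∃ β, β = B / 2 := ⟨_, rfl⟩
    have hβe : L * β ≤ 2 * e := by
      calc L * β ≤ L * (2 * e / L) := Nat.mul_le_mul_left _ (by omega)
        _ ≤ 2 * e := Nat.mul_div_le _ _
    have hLB : (16 * a + 16) * β ≤ L * β := Nat.mul_le_mul_right _ hL
    have h4β : B ≤ 4 * β := by omega
    have haB : a * B ≤ 4 * (a * β) := by
      calc a * B ≤ a * (4 * β) := Nat.mul_le_mul_left _ h4β
        _ = 4 * (a * β) := by ring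
    have haβ : β ≤ a * β := Nat.le_mul_of_pos_left _ ha
    have hLB' : 16 * (a * β) + 16 * β ≤ L * β := by
      calc 16 * (a * β) + 16 * β = (16 * a + 16) * β := by ring
        _ ≤ L * β := hLB
    -- Now `β = B / 2`, and `h = 2 ^ f` is as large as `h ^ 2 ≤ N ^ β` allows up to a constant
    -- factor; `hβe` yields `2 * h ≤ d`.
    obtain ⟨f, hf⟩ : ∃ f, f = L * β / 2 - 1 := ⟨_, rfl⟩
    have hfd : 2 * 2 ^ f ≤ d := by
      calc 2 * 2 ^ f = 2 ^ (f + 1) := by ring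
        _ ≤ 2 ^ e := Nat.pow_le_pow_right two_pos (by omega)
        _ ≤ d := Nat.pow_log_le_self 2 (by omega)
    obtain ⟨P, hP, -, Q, hB, hX⟩ :=
      exists_hard_instance (m := m) (d := d) (h := 2 ^ f) (B := B) (N := 2 ^ L)
        (β := β) (r := 2 * k + 3) hd hfd (by omega) (by positivity) hBN
        (by
          rw [← pow_mul, ← pow_mul]
          exact Nat.pow_le_pow_right two_pos (by omega))
        (sq_lt_pow_of_le hBN' hN2)
    refine ⟨P, hP, fun D T hD hT => ?_⟩
    have h1 := D.card_queries_le (n := a * B) (fun t => (Q t).answer P) hX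
      (fun t => by rw [hB]; omega) (T := fun t => T (Q t)) (fun t => hT _ (hB t)) (fun t => hD _)
    simp only [Fintype.card_prod, Fintype.card_fin] at h1
    have h2 : 2 * k + 3 < 2 ^ (2 * β) := by
      have : ∀ j, 10 ≤ j → 2 * j + 4 < 2 ^ (j - 1) := by
        intro j hj
        induction j, hj using Nat.le_induction with
        | base => norm_num
        | succ j hj ih =>
          obtain ⟨i, rfl⟩ : ∃ i, j = i + 1 := ⟨j - 1, by omega⟩
          simp only [Nat.add_sub_cancel] at ih ⊢
          rw [pow_succ]
          omega
      have h3 := this B (by omega)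
      have h4 : 2 ^ (B - 1) ≤ 2 ^ (2 * β) := Nat.pow_le_pow_right two_pos (by omega)
      omega
    have h3 : 2 ^ f * 2 ^ f < 2 ^ (4 * β + (3 * (a * B) + 1)) := by
      calc 2 ^ f * 2 ^ f ≤ (2 * k + 3) ^ 2 * 2 ^ (3 * (a * B) + 1) := h1
        _ < (2 ^ (2 * β)) ^ 2 * 2 ^ (3 * (a * B) + 1) := by gcongr
        _ = 2 ^ (4 * β + (3 * (a * B) + 1)) := by ring
    rw [← pow_add] at h3
    have h4 := (Nat.pow_lt_pow_iff_right one_lt_two).1 h3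
    -- The `2 ^ (2 * f)` queries give an exponent of at least `L * β - 3`, while the bound has at
    -- most `4 * β + 12 * a * β + 1`; `L ≥ 16 * a + 16` makes this impossible.
    omega

/-! ### Asymptotics of the exponents -/

/-- The loss `η` in the exponent of the space bounds. -/
noncomputable def spaceLoss (n : ℕ) : ℝ :=
  Real.log ((2 * (Nat.log 2 n : ℝ) + 3) ^ 4) / Real.log n +
    1 / √((Nat.log 2 (Nat.log 2 (Nat.log 2 n / 3)) : ℝ) + 1)

theorem tendsto_natLog_atTop : Tendsto (Nat.log 2) atTop atTop :=
  tendsto_atTop.2 fun b => (eventually_ge_atTop (2 ^ b)).mono fun _ hn =>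
    Nat.le_log_of_pow_le one_lt_two hn

theorem natLog_mul_log_two_le (n : ℕ) (hn : 1 ≤ n) :
    (Nat.log 2 n : ℝ) * Real.log 2 ≤ Real.log n := by
  rw [← Real.log_pow]
  refine Real.log_le_log (by positivity) ?_
  exact_mod_cast Nat.pow_log_le_self 2 (by omega : n ≠ 0)

theorem tendsto_polylog_exponent :
    Tendsto (fun n : ℕ => Real.log ((2 * (Nat.log 2 n : ℝ) + 3) ^ 4) / Real.log n) atTop (𝓝 0) := by
  have hu : Tendsto (fun n : ℕ => 2 * (Nat.log 2 n : ℝ) + 3) atTop atTop :=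
    tendsto_atTop_add_const_right _ _
      ((tendsto_natCast_atTop_atTop.comp tendsto_natLog_atTop).const_mul_atTop two_pos)
  have h0 := (Real.isLittleO_log_id_atTop.tendsto_div_nhds_zero.comp hu).const_mul 40
  rw [mul_zero] at h0
  refine squeeze_zero' (Eventually.of_forall fun n => ?_) ?_ h0
  · refine div_nonneg (Real.log_nonneg (one_le_pow₀ ?_)) (Real.log_natCast_nonneg n)
    have : (0 : ℝ) ≤ Nat.log 2 n := Nat.cast_nonneg _
    linarith
  · filter_upwards [eventually_ge_atTop 2] with n hn
    have h1 : (1 : ℝ) ≤ Nat.log 2 n := by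
      exact_mod_cast Nat.le_log_of_pow_le one_lt_two (by simpa using hn)
    have h2 := natLog_mul_log_two_le n (by omega)
    have h3 : (1 / 2 : ℝ) < Real.log 2 := by linarith [Real.log_two_gt_d9]
    have h4 : 0 ≤ Real.log (2 * (Nat.log 2 n : ℝ) + 3) := Real.log_nonneg (by linarith)
    have h5 : (2 * (Nat.log 2 n : ℝ) + 3) / 10 ≤ Real.log n := by nlinarith
    simp only [Function.comp_apply, id]
    rw [Real.log_pow, Nat.cast_ofNat]
    calc 4 * Real.log (2 * (Nat.log 2 n : ℝ) + 3) / Real.log n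
        ≤ 4 * Real.log (2 * (Nat.log 2 n : ℝ) + 3) / ((2 * (Nat.log 2 n : ℝ) + 3) / 10) := by
          gcongr
      _ = 40 * (Real.log (2 * (Nat.log 2 n : ℝ) + 3) / (2 * (Nat.log 2 n : ℝ) + 3)) := by
          field_simp
          ring

theorem tendsto_spaceLoss : Tendsto spaceLoss atTop (𝓝 0) := by
  have h3 : Tendsto (fun n : ℕ => n / 3) atTop atTop := Nat.tendsto_div_const_atTop (by norm_num)
  have h1 : Tendsto (fun n : ℕ => √((Nat.log 2 (Nat.log 2 (Nat.log 2 n / 3)) : ℝ) + 1)) atTop atTop :=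
    Real.tendsto_sqrt_atTop.comp <| tendsto_atTop_add_const_right _ _ <|
      tendsto_natCast_atTop_atTop.comp <| tendsto_natLog_atTop.comp <|
        tendsto_natLog_atTop.comp <| h3.comp tendsto_natLog_atTop
  have := tendsto_polylog_exponent.add h1.inv_tendsto_atTop
  rw [add_zero] at this
  exact this.congr fun n => by rw [spaceLoss, one_div, Pi.inv_apply]

theorem rpow_div_log {x y : ℝ} (hx : 1 < x) (hy : 0 < y) : x ^ (Real.log y / Real.log x) = y := by
  rw [Real.rpow_def_of_pos (by linarith), mul_div_cancel₀ _ (Real.log_pos hx).ne', Real.exp_log hy]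

theorem rpow_spaceLoss {n : ℕ} (hn : 2 ≤ n) :
    (n : ℝ) ^ spaceLoss n = (2 * (Nat.log 2 n : ℝ) + 3) ^ 4 *
      (n : ℝ) ^ (1 / √((Nat.log 2 (Nat.log 2 (Nat.log 2 n / 3)) : ℝ) + 1)) := by
  have : (1 : ℝ) < n := by exact_mod_cast hn
  rw [spaceLoss, Real.rpow_add (by linarith), rpow_div_log this (by positivity)]

theorem pow_four_le_rpow_spaceLoss {n : ℕ} (hn : 2 ≤ n) :
    (2 * (Nat.log 2 n : ℝ) + 3) ^ 4 ≤ (n : ℝ) ^ spaceLoss n := by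
  rw [rpow_spaceLoss hn]
  refine le_mul_of_one_le_right (by positivity) (Real.one_le_rpow ?_ (by positivity))
  exact_mod_cast (by omega : 1 ≤ n)

theorem rpow_two_sub_spaceLoss {n : ℕ} (hn : 2 ≤ n) :
    (n : ℝ) ^ (2 - spaceLoss n) = (n : ℝ) ^ 2 / (n : ℝ) ^ spaceLoss n := by
  rw [Real.rpow_sub (by positivity), Real.rpow_two]

/-- The true exponent is about `50 * a / L`, but `η` is fixed before the constant `A`, hence before
`a`. Weakening `1 / L` to an inverse square root absorbs every `a` once `L ≥ 5000 * a ^ 2`. -/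
theorem two_pow_le_rpow {n e L a F : ℕ} (hn : 2 ≤ n) (he : (e : ℝ) * Real.log 2 ≤ Real.log n)
    (ha : 1 ≤ a) (hL : 5000 * a ^ 2 ≤ L) (hFL : F ≤ L) :
    (2 : ℝ) ^ (25 * a * (2 * e / L + 1)) ≤ 2 ^ (25 * a) * (n : ℝ) ^ (1 / √((F : ℝ) + 1)) := by
  have ha0 : (1 : ℝ) ≤ a := by exact_mod_cast ha
  have hLr : (5000 : ℝ) * a ^ 2 ≤ L := by exact_mod_cast hL
  have hLr0 : (5000 : ℝ) ≤ L := by nlinarith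
  have hn1 : (1 : ℝ) < n := by exact_mod_cast hn
  have hζ : 50 * (a : ℝ) / L ≤ 1 / √((F : ℝ) + 1) := by
    have h1 : √((F : ℝ) + 1) ≤ L / (50 * a) := by
      refine Real.sqrt_le_iff.2 ⟨by positivity, ?_⟩
      have h2 : (F : ℝ) ≤ L := by exact_mod_cast hFL
      rw [div_pow, le_div_iff₀ (by positivity)]
      calc ((F : ℝ) + 1) * (50 * a) ^ 2 ≤ (2 * L) * (50 * a) ^ 2 := by
            gcongr
            linarith
        _ = L * (5000 * (a : ℝ) ^ 2) := by ring
        _ ≤ (L : ℝ) * L := by gcongr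
        _ = (L : ℝ) ^ 2 := (sq _).symm
    rw [le_div_iff₀ (by positivity), div_mul_eq_mul_div, div_le_iff₀ (by linarith), one_mul]
    calc 50 * (a : ℝ) * √((F : ℝ) + 1) ≤ 50 * a * (L / (50 * a)) := by gcongr
      _ = L := by field_simp
  rw [mul_add, mul_one, pow_add, mul_comm]
  gcongr
  rw [← Real.rpow_natCast, Real.rpow_def_of_pos two_pos, Real.rpow_def_of_pos (by linarith)]
  refine Real.exp_le_exp.2 ?_
  have h1 : ((2 * e / L : ℕ) : ℝ) ≤ 2 * e / L := by
    simpa using (Nat.cast_div_le : ((2 * e / L : ℕ) : ℝ) ≤ ((2 * e : ℕ) : ℝ) / L)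
  have h3 : 0 ≤ Real.log 2 := Real.log_nonneg (by norm_num)
  have h4 : 0 ≤ Real.log n := Real.log_nonneg hn1.le
  calc Real.log 2 * ((25 * a * (2 * e / L) : ℕ) : ℝ)
      = Real.log 2 * (25 * a * ((2 * e / L : ℕ) : ℝ)) := by push_cast; rfl
    _ ≤ Real.log 2 * (25 * a * (2 * e / L)) := by gcongr
    _ = 50 * a / L * (e * Real.log 2) := by ring
    _ ≤ 50 * a / L * Real.log n := by gcongr
    _ ≤ _ := by
      rw [mul_comm]
      gcongr

theorem tendsto_reporting_exponent :
    Tendsto (fun m : ℕ => Real.log (2 * (Nat.log 2 m : ℝ) ^ 2) / Real.log m) atTop (𝓝 0) := by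
  refine squeeze_zero' ?_ ?_ tendsto_polylog_exponent
  · filter_upwards [eventually_ge_atTop 2] with m hm
    have h1 : (1 : ℝ) ≤ Nat.log 2 m := by
      exact_mod_cast Nat.le_log_of_pow_le one_lt_two (by simpa using hm)
    refine div_nonneg (Real.log_nonneg ?_) (Real.log_natCast_nonneg m)
    nlinarith
  · filter_upwards [eventually_ge_atTop 2] with m hm
    have h1 : (1 : ℝ) ≤ Nat.log 2 m := by
      exact_mod_cast Nat.le_log_of_pow_le one_lt_two (by simpa using hm)
    have h2 := Real.log_natCast_nonneg m
    gcongr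
    calc 2 * (Nat.log 2 m : ℝ) ^ 2 ≤ (2 * (Nat.log 2 m : ℝ) + 3) ^ 2 := by nlinarith
      _ ≤ (2 * (Nat.log 2 m : ℝ) + 3) ^ 4 := pow_le_pow_right₀ (by linarith) (by norm_num)

/-- The factor `β` is absorbed by `β ≤ 2 ^ (a * β)`, which raises `24` to `25`; the factor `k ^ 2`
lost in `B` raises the polylogarithm to a fourth power. -/
theorem mul_sq_le_of_reporting {m d k B β a S Λ : ℕ} (hd : 2 ≤ d) (ha : 1 ≤ a)
    (hmB : m ≤ 2 * k ^ 2 * B) (hk : k ≤ Λ)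
    (h : (d / 2) ^ 2 * B ≤ 8 * β * ((2 * k + 3) ^ 2 * (S * 2 ^ (24 * a * β + 1)))) :
    m * d ^ 2 ≤ 288 * ((2 * Λ + 3) ^ 4 * S) * 2 ^ (25 * a * β) := by
  have hβ2 : β ≤ 2 ^ (a * β) := Nat.lt_two_pow_self.le.trans
    (Nat.pow_le_pow_right two_pos (Nat.le_mul_of_pos_left β ha))
  calc m * d ^ 2 ≤ 2 * k ^ 2 * B * (3 * (d / 2)) ^ 2 :=
        Nat.mul_le_mul hmB (Nat.pow_le_pow_left (by omega) 2)
    _ = 18 * k ^ 2 * ((d / 2) ^ 2 * B) := by ring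
    _ ≤ 18 * k ^ 2 * (8 * β * ((2 * k + 3) ^ 2 * (S * 2 ^ (24 * a * β + 1)))) :=
        Nat.mul_le_mul_left _ h
    _ ≤ 18 * (2 * k + 3) ^ 2 *
        (8 * 2 ^ (a * β) * ((2 * k + 3) ^ 2 * (S * 2 ^ (24 * a * β + 1)))) := by
        gcongr
        omega
    _ = 288 * ((2 * k + 3) ^ 4 * S) * 2 ^ (25 * a * β) := by
        rw [show 25 * a * β = 24 * a * β + a * β by ring, pow_add, pow_succ]
        ring
    _ ≤ _ := by gcongr

/-- The loss `η` is a function of `n` alone. In the range `2 * β ≤ B` the dimension is at most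
exponential in `m`, so `log log m` is at least the iterated logarithm of `n` used in `spaceLoss`. -/
theorem log_mul_div_three_le {m d L B β : ℕ} (hm : 1 ≤ m) (hL : 0 < L) (hLB : L * B ≤ m)
    (hβ : β = 2 * Nat.log 2 d / L + 1) (h2β : 2 * β ≤ B) : Nat.log 2 (m * d) / 3 ≤ m := by
  have heLB : Nat.log 2 d < L * B := by
    have h1 : 2 * Nat.log 2 d < L * β := hβ ▸ Nat.lt_mul_div_succ _ hL
    have h2 : L * (2 * β) ≤ L * B := Nat.mul_le_mul_left _ h2β
    linarith
  have h1 : m < 2 ^ (Nat.log 2 m + 1) := Nat.lt_pow_succ_log_self one_lt_two m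
  have h2 : d < 2 ^ (Nat.log 2 d + 1) := Nat.lt_pow_succ_log_self one_lt_two d
  have h3 : Nat.log 2 (m * d) < Nat.log 2 m + 1 + (Nat.log 2 d + 1) := by
    refine Nat.log_lt_of_lt_pow' (by omega) ?_
    rw [pow_add]
    exact Nat.mul_lt_mul'' h1 h2
  have h4 : Nat.log 2 m < m := Nat.log_lt_self 2 (by omega)
  omega

/-! ### The two lower bounds -/

theorem searching_lower_bound.{u} (γ : ℕ → ℝ) (hγ : Tendsto γ atTop (𝓝 0)) :
    ∃ δ η : ℕ → ℝ, Tendsto δ atTop (𝓝 0) ∧ Tendsto η atTop (𝓝 0) ∧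
      ∃ c : ℝ, 0 < c ∧ ∃ m₀ : ℕ, ∀ m d : ℕ, m₀ ≤ m → 1 ≤ d →
        Real.log (d : ℝ) ≤ (m : ℝ) ^ γ m →
        ∃ P : Finset (Fin d → ℝ), P.card = m ∧
          ∀ (G : Type u) [AddCommSemigroup G] (D : SumScheme (Fin d → ℝ) (TwoSidedQuery d)),
            (FaithfulSemigroup G ∧ D.Solves G (fun q => q.answer P)) ∨
              (AdaptivelyFaithfulSemigroup G ∧ D.SolvesAdaptively G (fun q => q.answer P)) →
            (∀ q : TwoSidedQuery d, ((D.pick q).card : ℝ) ≤ (m : ℝ) ^ (1 - δ m)) →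
            c * (((m * d : ℕ) : ℝ) ^ (2 - η (m * d)) / (m : ℝ) ^ 2) ≤ (D.size : ℝ) := by
  -- This `δ` makes `m ^ (1 - δ m)` equal to `m / (64 * (m ^ γ m + 1))`, below `B / β` up to
  -- constants since `log d ≤ m ^ γ m`.
  refine ⟨fun m => Real.log (64 * ((m : ℝ) ^ γ m + 1)) / Real.log m, spaceLoss, ?_,
    tendsto_spaceLoss, 1 / 9, by norm_num, 8, fun m d hm hd hdm => ?_⟩
  · have hlog : Tendsto (fun m : ℕ => Real.log m) atTop atTop :=
      Real.tendsto_log_atTop.comp tendsto_natCast_atTop_atTop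
    have h1 : Tendsto (fun m : ℕ => Real.log 128 / Real.log m + |γ m|) atTop (𝓝 0) := by
      simpa using (tendsto_const_nhds.div_atTop hlog).add hγ.abs
    refine squeeze_zero' (Eventually.of_forall fun m => ?_) ?_ h1
    · refine div_nonneg (Real.log_nonneg ?_) (Real.log_natCast_nonneg m)
      have : 0 ≤ (m : ℝ) ^ γ m := by positivity
      linarith
    · filter_upwards [eventually_ge_atTop 2] with m hm
      have hm1 : (1 : ℝ) < m := by exact_mod_cast hm
      have hpos := Real.log_pos hm1
      rw [div_add' _ _ _ hpos.ne']
      gcongr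
      have h2 : (m : ℝ) ^ γ m ≤ (m : ℝ) ^ |γ m| :=
        Real.rpow_le_rpow_of_exponent_le hm1.le (le_abs_self _)
      have h3 : (1 : ℝ) ≤ (m : ℝ) ^ |γ m| := Real.one_le_rpow hm1.le (abs_nonneg _)
      rw [← Real.log_rpow (by linarith), ← Real.log_mul (by norm_num) (by positivity)]
      exact Real.log_le_log (by positivity) (by linarith)
  · obtain ⟨P, hP, h⟩ := exists_points_searching.{u} hd (by omega : 4 ≤ m)
    refine ⟨P, hP, fun G _ D hD hT => ?_⟩
    have hm8 : (8 : ℝ) ≤ m := by exact_mod_cast hm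
    set g := (m : ℝ) ^ γ m with hg
    have hg0 : 0 ≤ g := by positivity
    have hpow : (m : ℝ) ^ (1 - Real.log (64 * (g + 1)) / Real.log m) = m / (64 * (g + 1)) := by
      rw [Real.rpow_sub (by linarith), Real.rpow_one,
        rpow_div_log (by linarith) (by positivity)]
    replace hT : ∀ q : TwoSidedQuery d, ((D.pick q).card : ℝ) ≤ m / (64 * (g + 1)) :=
      fun q => hpow ▸ hT q
    have he : (Nat.log 2 d : ℝ) ≤ 2 * g := by
      have h1 := natLog_mul_log_two_le d hd
      have h3 : (1 / 2 : ℝ) < Real.log 2 := by linarith [Real.log_two_gt_d9]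
      have h4 : (0 : ℝ) ≤ Nat.log 2 d := Nat.cast_nonneg _
      nlinarith
    obtain ⟨h1, h2⟩ := h G D hD fun q => by
      have h1 : ((D.pick q).card : ℝ) * (2 * Nat.log 2 d) ≤ m / 16 := by
        calc ((D.pick q).card : ℝ) * (2 * Nat.log 2 d) ≤ m / (64 * (g + 1)) * (2 * (2 * g)) := by
              gcongr
              exact hT q
          _ ≤ m / (64 * (g + 1)) * (4 * (g + 1)) :=
              mul_le_mul_of_nonneg_left (by linarith) (by positivity)
          _ = m / 16 := by
              field_simp
              norm_num
      have h2 : (D.pick q).card * (2 * Nat.log 2 d) * 16 ≤ m := by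
        have : ((D.pick q).card : ℝ) * (2 * Nat.log 2 d) * 16 ≤ m := by linarith
        exact_mod_cast this
      omega
    have hn : 2 ≤ m * d := by nlinarith
    have hm0 : (0 : ℝ) < m := by linarith
    have hη := pow_four_le_rpow_spaceLoss hn
    set n := m * d with hn'
    have hΛ0 : (0 : ℝ) ≤ Nat.log 2 n := Nat.cast_nonneg _
    have hη2 : (2 * (Nat.log 2 n : ℝ) + 3) ^ 2 ≤ (n : ℝ) ^ spaceLoss n :=
      (pow_le_pow_right₀ (by linarith) (by norm_num)).trans hη
    have hη0 : (0 : ℝ) < (n : ℝ) ^ spaceLoss n := by positivity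
    have hmn : Nat.log 2 m ≤ Nat.log 2 n := Nat.log_mono_right (Nat.le_mul_of_pos_right m hd)
    have key : (d : ℝ) ^ 2 ≤ 9 * ((n : ℝ) ^ spaceLoss n * D.size) := by
      have hS : (1 : ℝ) ≤ D.size := by exact_mod_cast h2
      -- For `d = 1` the count `(d / 2) ^ 2` is zero, and the existence of one precomputed sum
      -- suffices.
      rcases hd.eq_or_lt with rfl | hd2
      · have : (1 : ℝ) ≤ (n : ℝ) ^ spaceLoss n := (one_le_pow₀ (by linarith)).trans hη
        push_cast
        nlinarith
      · have h3 : d ^ 2 ≤ 9 * (d / 2) ^ 2 := by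
          calc d ^ 2 ≤ (3 * (d / 2)) ^ 2 := Nat.pow_le_pow_left (by omega) 2
            _ = 9 * (d / 2) ^ 2 := by ring
        have h4 : d ^ 2 ≤ 9 * ((2 * Nat.log 2 n + 3) ^ 2 * D.size) :=
          h3.trans (Nat.mul_le_mul_left _ (h1.trans (by gcongr)))
        have h5 : (d : ℝ) ^ 2 ≤ 9 * ((2 * (Nat.log 2 n : ℝ) + 3) ^ 2 * D.size) := by
          exact_mod_cast h4
        exact h5.trans (by gcongr)
    rw [rpow_two_sub_spaceLoss hn]
    have e1 : (1 / 9 : ℝ) * ((n : ℝ) ^ 2 / (n : ℝ) ^ spaceLoss n / (m : ℝ) ^ 2) =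
        (d : ℝ) ^ 2 / (9 * (n : ℝ) ^ spaceLoss n) := by
      have : (n : ℝ) ^ 2 = (m : ℝ) ^ 2 * (d : ℝ) ^ 2 := by
        rw [hn']
        push_cast
        ring
      rw [this]
      field_simp
    rw [e1, div_le_iff₀ (by positivity)]
    linarith

theorem reporting_lower_bound :
    ∃ δ η : ℕ → ℝ, Tendsto δ atTop (𝓝 0) ∧ Tendsto η atTop (𝓝 0) ∧
      ∀ A : ℝ, ∃ c : ℝ, 0 < c ∧ ∃ m₀ : ℕ, ∀ m d : ℕ, m₀ ≤ m → 1 ≤ d →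
        ∃ P : Finset (Fin d → ℝ), P.card = m ∧
          ∀ D : PointerStructure (Fin d → ℝ),
            (∀ q : TwoSidedQuery d,
              D.ReportsWithin (q.answer P)
                ((m : ℝ) ^ (1 - δ m) + A * ((q.answer P).card : ℝ))) →
            c * (((m * d : ℕ) : ℝ) ^ (2 - η (m * d)) / (m : ℝ)) ≤ (D.size : ℝ) := by
  -- Here `m ^ (1 - δ m) = m / (2 * k ^ 2) ≤ B`, so a query with `B` answers has time at most `(1 +
  -- A) * B ≤ a * B`.
  refine ⟨fun m => Real.log (2 * (Nat.log 2 m : ℝ) ^ 2) / Real.log m, spaceLoss,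
    tendsto_reporting_exponent, tendsto_spaceLoss, fun A => ?_⟩
  obtain ⟨a, ha1, haA⟩ : ∃ a : ℕ, 1 ≤ a ∧ A + 1 ≤ a := ⟨⌈A⌉₊ + 1, by omega, by
    push_cast
    linarith [Nat.le_ceil A]⟩
  obtain ⟨m₀, hm₀⟩ := eventually_atTop.1 ((tendsto_natLog_atTop.comp tendsto_natLog_atTop
    ).eventually_ge_atTop (5000 * a ^ 2))
  refine ⟨1 / (288 * 2 ^ (25 * a)), by positivity, max m₀ 2, fun m d hm hd => ?_⟩
  have hm2 : 2 ≤ m := (le_max_right _ _).trans hm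
  have hL : 5000 * a ^ 2 ≤ Nat.log 2 (Nat.log 2 m) := hm₀ m ((le_max_left _ _).trans hm)
  obtain ⟨P, hP, h⟩ := exists_points_reporting (m := m) hd ha1 (by nlinarith)
  refine ⟨P, hP, fun D hD => ?_⟩
  set k := Nat.log 2 m with hk
  set L := Nat.log 2 k with hL'
  set B := m / k ^ 2 with hB
  set e := Nat.log 2 d with he
  have hL0 : 5000 ≤ L := le_trans (by nlinarith) hL
  have hNk : 2 ^ L ≤ k := Nat.pow_log_le_self 2 (by
    rintro h0
    rw [h0] at hL'
    simp at hL'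
    omega)
  have hLk : L < k := Nat.lt_two_pow_self.trans_le hNk
  have hkm : 2 ^ k ≤ m := Nat.pow_log_le_self 2 (by omega)
  have hk2 : k ^ 2 ≤ m := calc
    k ^ 2 ≤ k ^ 3 := Nat.pow_le_pow_right (by omega) (by norm_num)
    _ ≤ 2 ^ k := cube_le_two_pow (by omega)
    _ ≤ m := hkm
  have hkk : 0 < k ^ 2 := Nat.pow_pos (by omega)
  have hB1 : 1 ≤ B := (Nat.one_le_div_iff hkk).2 hk2
  have hBm : k ^ 2 * B ≤ m := Nat.mul_div_le m (k ^ 2)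
  have hmB : m ≤ 2 * k ^ 2 * B := by
    have := Nat.lt_mul_div_succ m (b := k ^ 2) hkk
    nlinarith
  have hm1 : (1 : ℝ) < m := by exact_mod_cast hm2
  have hk0 : (0 : ℝ) < k := by exact_mod_cast (by omega : 0 < k)
  have hpow : (m : ℝ) ^ (1 - Real.log (2 * (k : ℝ) ^ 2) / Real.log m) ≤ B := by
    rw [Real.rpow_sub (by linarith), Real.rpow_one, rpow_div_log hm1 (by positivity),
      div_le_iff₀ (by positivity)]
    calc (m : ℝ) ≤ (2 * k ^ 2 * B : ℕ) := by exact_mod_cast hmB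
      _ = B * (2 * (k : ℝ) ^ 2) := by
        push_cast
        ring
  obtain ⟨hmS, β, hβ, h2β, hmain⟩ := h D _ hD fun q hq => by
    rw [hq]
    push_cast
    nlinarith [(Nat.cast_nonneg B : (0 : ℝ) ≤ B)]
  have hn : 2 ≤ m * d := by nlinarith
  have hmn : m ≤ m * d := Nat.le_mul_of_pos_right m hd
  have hdn : d ≤ m * d := Nat.le_mul_of_pos_left d (by omega)
  have hη := pow_four_le_rpow_spaceLoss hn
  have hη' := rpow_spaceLoss hn
  have hnmd : ((m * d : ℕ) : ℝ) = m * d := Nat.cast_mul m d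
  rw [rpow_two_sub_spaceLoss hn]
  obtain ⟨n, hn'⟩ : ∃ n, n = m * d := ⟨_, rfl⟩
  rw [← hn'] at hn hmn hdn hη hη' hnmd ⊢
  have hn1 : (1 : ℝ) < n := by exact_mod_cast hn
  have hΛ0 : (0 : ℝ) ≤ Nat.log 2 n := Nat.cast_nonneg _
  have hη0 : (0 : ℝ) < (n : ℝ) ^ spaceLoss n := by positivity
  have hS0 : (m : ℝ) ≤ D.size := by exact_mod_cast hmS
  have key : (m : ℝ) * (d : ℝ) ^ 2 ≤ 288 * 2 ^ (25 * a) * ((n : ℝ) ^ spaceLoss n * D.size) := by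
    rcases hd.eq_or_lt with rfl | hd2
    · have h1 : (1 : ℝ) ≤ (n : ℝ) ^ spaceLoss n := (one_le_pow₀ (by linarith)).trans hη
      have h2 : (1 : ℝ) ≤ 2 ^ (25 * a) := one_le_pow₀ (by norm_num)
      have h3 : (D.size : ℝ) ≤ (n : ℝ) ^ spaceLoss n * D.size :=
        le_mul_of_one_le_left (Nat.cast_nonneg _) h1
      push_cast
      nlinarith
    · have hkn : k ≤ Nat.log 2 n := Nat.log_mono_right hmn
      have hnat := mul_sq_le_of_reporting hd2 ha1 hmB hkn hmain
      have hLBm : L * B ≤ m := by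
        refine le_trans (Nat.mul_le_mul_right _ ?_) hBm
        exact hLk.le.trans (Nat.le_self_pow two_ne_zero k)
      have hΛ : Nat.log 2 n / 3 ≤ m :=
        hn' ▸ log_mul_div_three_le (by omega) (by omega) hLBm hβ h2β
      have he' : (e : ℝ) * Real.log 2 ≤ Real.log n :=
        (natLog_mul_log_two_le d hd).trans
          (Real.log_le_log (by exact_mod_cast hd) (by exact_mod_cast hdn))
      have hFL : Nat.log 2 (Nat.log 2 (Nat.log 2 n / 3)) ≤ L :=
        Nat.log_mono_right (Nat.log_mono_right hΛ)
      have hexp := two_pow_le_rpow hn he' ha1 hL hFL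
      rw [← hβ] at hexp
      have hreal : (m : ℝ) * (d : ℝ) ^ 2 ≤
          288 * ((2 * (Nat.log 2 n : ℝ) + 3) ^ 4 * D.size) * 2 ^ (25 * a * β) := by
        exact_mod_cast hnat
      calc (m : ℝ) * (d : ℝ) ^ 2
          ≤ 288 * ((2 * (Nat.log 2 n : ℝ) + 3) ^ 4 * D.size) * (2 ^ (25 * a) *
            (n : ℝ) ^ (1 / √((Nat.log 2 (Nat.log 2 (Nat.log 2 n / 3)) : ℝ) + 1))) :=
            hreal.trans (by gcongr)
        _ = _ := by
            rw [hη']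
            ring
  have e1 : 1 / (288 * 2 ^ (25 * a)) * ((n : ℝ) ^ 2 / (n : ℝ) ^ spaceLoss n / m) =
      m * (d : ℝ) ^ 2 / (288 * 2 ^ (25 * a) * (n : ℝ) ^ spaceLoss n) := by
    generalize (n : ℝ) ^ spaceLoss n = E at hη0
    rw [hnmd]
    field_simp
  rw [e1, div_le_iff₀ (by positivity)]
  linarith

theorem mainTheorem7 :
    -- reporting, pointer machine model
    (∃ δ η : ℕ → ℝ, Tendsto δ atTop (𝓝 0) ∧ Tendsto η atTop (𝓝 0) ∧
      ∀ A : ℝ, ∃ c : ℝ, 0 < c ∧ ∃ m₀ : ℕ, ∀ m d : ℕ, m₀ ≤ m → 1 ≤ d →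
        ∃ P : Finset (Fin d → ℝ), P.card = m ∧
          ∀ D : PointerStructure (Fin d → ℝ),
            (∀ q : TwoSidedQuery d,
              D.ReportsWithin (q.answer P)
                ((m : ℝ) ^ (1 - δ m) + A * ((q.answer P).card : ℝ))) →
            c * (((m * d : ℕ) : ℝ) ^ (2 - η (m * d)) / (m : ℝ)) ≤ (D.size : ℝ)) ∧
    -- searching, semigroup model
    (∀ γ : ℕ → ℝ, Tendsto γ atTop (𝓝 0) →
      ∃ δ η : ℕ → ℝ, Tendsto δ atTop (𝓝 0) ∧ Tendsto η atTop (𝓝 0) ∧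
        ∃ c : ℝ, 0 < c ∧ ∃ m₀ : ℕ, ∀ m d : ℕ, m₀ ≤ m → 1 ≤ d →
          Real.log (d : ℝ) ≤ (m : ℝ) ^ γ m →
          ∃ P : Finset (Fin d → ℝ), P.card = m ∧
            ∀ (G : Type*) [AddCommSemigroup G] (D : SumScheme (Fin d → ℝ) (TwoSidedQuery d)),
              (FaithfulSemigroup G ∧ D.Solves G (fun q => q.answer P)) ∨
                (AdaptivelyFaithfulSemigroup G ∧ D.SolvesAdaptively G (fun q => q.answer P)) →
              (∀ q : TwoSidedQuery d, ((D.pick q).card : ℝ) ≤ (m : ℝ) ^ (1 - δ m)) →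
              c * (((m * d : ℕ) : ℝ) ^ (2 - η (m * d)) / (m : ℝ) ^ 2) ≤ (D.size : ℝ)) := by
  exact ⟨reporting_lower_bound, fun γ hγ => searching_lower_bound γ hγ⟩
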